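/- **Setting.** Let $X$ be a complete separable metric space with a continuous (additive) group operation, and let $f,g:X^2\to X$ be continuous. Put $\tau_n=2^{-n}$, $\mathbb N=\{1,2,\dots\}$, $\mathcal L=\{(n,t): t=m\tau_n,\ n,m\in\mathbb N\}$. Given initial conditions $a=(a_1,a_2,\dots)\in X^{\mathbb N}$ and boundary conditions $b=(b_0,b_1,\dots)$ in $X$, a *weak solution of the ideal system* is a field $(u_n(t))_{(n,t)\in\mathcal L}\in X^{\mathcal L}$ which, with $u_n(0)=a_n$ and $u_0(t)=b_t$, satisfies at every $(n,t)\in\mathcal L$ $$u_n(t)=\begin{cases} f\big(u_n(t-\tau_n),u_{n+1}(t-\tau_n)\big), & t/\tau_n \text{ odd},\\ f\big(u_n(t-\tau_n),u_{n+1}(t-\tau_n)\big)+g\big(u_{n-1}(t-2\tau_n),u_n(t-2\tau_n)\big), & t/\tau_n\text{ even}.\end{cases}\tag{1}$$ Let $x_0,x_1,\dots$ be i.i.d. $X$-valued random variables with law $\mu_x$. For $N\in\mathbb N$ the *stochastically regularized solution* $\mathfrak u^{(N)}$ is defined by $\mathfrak u^{(N)}_{N+1}(t)=x_{t/\tau_{N+1}}$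 and $\mathfrak u^{(N)}_n(t)=0$ for $n>N+1$ (for all $t\ge 0$), and for $n\le N$ by (1) with the initial conditions $a_1,\dots,a_N$ and boundary conditions $b$. Let $\mathcal P^{(N)}$ be its law on $X^{\mathcal L}$ (product topology), and let $\Psi^{(N)}(\cdot\,|\,a)$ be the law on $X^{\mathbb N}$ of $(\mathfrak u^{(N)}_1(\tau_1),\mathfrak u^{(N)}_2(\tau_1),\dots)$, which does not depend on $b$. For kernels on $X^{\mathbb N}$ let $(\Psi'\circ\Psi)(A|a)=\int\Psi'(A|u)\,\Psi(du|a)$, and for a map $h$ of $X^{\mathbb N}$ with deterministic kernel $H(\cdot|a)=\delta_{h(a)}$ let $(\Psi*H)(A|a)=\Psi(\{u:u+h(a)\in A\}\,|\,a)$. Let $\Sigma_+,\Sigma_-,\Xi,B_b$ be the deterministic kernels of the maps $\sigma_+:a\mapsto(a_2,a_3,\dots)$, $\sigma_-:a\mapsto(0,a_1,a_2,\dots)$, $\xi:a\mapsto(f(a_1,a_2),g(a_1,a_2),0,0,\dots)$, $\beta_b:a\mapsto(g(b,a_1),0,0,\dots)$. The stochastic RG operator is $\mathfrak R_g[\Psi]=(\Sigma_-\circ\Psi\circ\Psi\circ\Sigma_+)*\Xi$.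 We write $\Psi^{(N)}\to\Psi^\infty$ if $\int\varphi(u)\,\Psi^{(N)}(du|a_N)\to\int\varphi(u)\,\Psi^\infty(du|a)$ for every convergent sequence $a_N\to a$ in $X^{\mathbb N}$ and every bounded uniformly continuous $\varphi:X^{\mathbb N}\to\mathbb R$. **Theorem (Spontaneous stochasticity).** Let the probability kernel $\Psi^\infty$ be a fixed point, $\Psi^\infty=\mathfrak R_g[\Psi^\infty]$, with $\Psi^{(N)}\to\Psi^\infty$. Then, for any initial conditions $a$ and boundary conditions $b$, the measures $\mathcal P^{(N)}$ converge weakly to a probability measure $\mathcal P^\infty$ on $X^{\mathcal L}$, and: 1. $\mathcal P^\infty$-almost every field is a weak solution of the ideal system with the initial conditions $a$ and boundary conditions $b$. 2. Under $\mathcal P^\infty$, the states $u(t)=(u_1(t),u_2(t),\dots)$ at integer times $t=0,1,2,\dots$ form a Markov chain with $u(0)=a$ and with transition kernel $\Phi^\infty_{b_t}$ from time $t$ to time $t+1$, where $\Phi^\infty_b=(\Psi^\infty\circ\Psi^\infty)*B_b$. In particular $u(t)$ has the law $P^\infty_t(\cdot|a)$ with $P^\infty_t=\Phi^\infty_{b_{t-1}}\circ\cdots\circ\Phi^\infty_{b_0}$.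 3. At non-integer times, let $P^\infty_t$ be the law under $\mathcal P^\infty$ of $(u_{n}(t),u_{n+1}(t),\dots)$ when $t=i+\tau_{n_1}+\dots+\tau_{n_c}$ with $i\in\mathbb N_0$, $1\le n_1<\dots<n_c=n$, $c\ge 1$. Then $P^\infty_t=\Psi^\infty\circ\Sigma_+^{n_1-1}\circ P^\infty_i$ if $c=1$, and $P^\infty_t=\Psi^\infty\circ\Sigma_+^{n_c-n_{c-1}}\circ P^\infty_{t-\tau_{n_c}}$ if $c\ge 2$. -/

import Mathlib

open MeasureTheory ProbabilityTheory Filter Topology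

noncomputable section

namespace SpontStoch

/-- Points `(n, m)`, `n, m ≥ 1`, of the multi-scale space-time lattice: `(n, m)` stands for the
scale `n` and the time `t = m τ_n`, where `τ_n = 2 ^ (-n)`. -/
abbrev Lattice : Type := {p : ℕ × ℕ // 1 ≤ p.1 ∧ 1 ≤ p.2}

variable {X : Type*}

/-- The values of a field on all space-time points `(n, m)` with `n, m ≥ 0`: the boundary values
`u_0(t) = b_t`, the initial values `u_n(0) = a_n` (`n ≥ 1`), and the lattice values otherwise.
Sequences `a = (a_1, a_2, …)` are functions `ℕ → X` with `a_n` the value at `n - 1`. -/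
def extendField (a b : ℕ → X) (u : Lattice → X) (n m : ℕ) : X :=
  if hn : 1 ≤ n then
    if hm : 1 ≤ m then u ⟨(n, m), hn, hm⟩ else a (n - 1)
  else b m

/-- The state `(u_s(t), u_{s+1}(t), u_{s+2}(t), …)` at time `t = m τ_s`, for a scale `s ≥ 1`;
note that `m τ_s = (m 2 ^ k) τ_{s + k}`. -/
def stateAt (a b : ℕ → X) (s m : ℕ) (u : Lattice → X) : ℕ → X :=
  fun k => extendField a b u (s + k) (m * 2 ^ k)

/-- The state `(u_1(t), u_2(t), …)` at an integer time `t = (2 t) τ_1`. -/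
def stateAtInt (a b : ℕ → X) (t : ℕ) (u : Lattice → X) : ℕ → X :=
  stateAt a b 1 (2 * t) u

section Maps

variable [TopologicalSpace X]

/-- The shift `a ↦ (a_2, a_3, …)`. -/
def shiftUp (a : ℕ → X) : ℕ → X := fun k => a (k + 1)

/-- The shift `a ↦ (0, a_1, a_2, …)`. -/
def shiftDown [Zero X] (a : ℕ → X) : ℕ → X
  | 0 => 0
  | k + 1 => a k

/-- The coupling map `a ↦ (f(a_1, a_2), g(a_1, a_2), 0, 0, …)`. -/
def couplingMap [Zero X] (f g : C(X × X, X)) (a : ℕ → X) : ℕ → X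
  | 0 => f (a 0, a 1)
  | 1 => g (a 0, a 1)
  | _ + 2 => 0

/-- The boundary map `a ↦ (g(b, a_1), 0, 0, …)`. -/
def boundaryMap [Zero X] (g : C(X × X, X)) (b : X) (a : ℕ → X) : ℕ → X
  | 0 => g (b, a 0)
  | _ + 1 => 0

lemma continuous_shiftUp : Continuous (shiftUp : (ℕ → X) → ℕ → X) :=
  continuous_pi fun k => continuous_apply (k + 1)

lemma continuous_shiftDown [Zero X] : Continuous (shiftDown : (ℕ → X) → ℕ → X) :=
  continuous_pi fun k => match k with
    | 0 => continuous_const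
    | k + 1 => continuous_apply k

lemma continuous_couplingMap [Zero X] (f g : C(X × X, X)) : Continuous (couplingMap f g) :=
  continuous_pi fun k => match k with
    | 0 => f.continuous.comp ((continuous_apply 0).prodMk (continuous_apply 1))
    | 1 => g.continuous.comp ((continuous_apply 0).prodMk (continuous_apply 1))
    | _ + 2 => continuous_const

lemma continuous_boundaryMap [Zero X] (g : C(X × X, X)) (b : X) :
    Continuous (boundaryMap g b) :=
  continuous_pi fun k => match k with
    | 0 => g.continuous.comp (continuous_const.prodMk (continuous_apply 0))
    | _ + 1 => continuous_const

end Maps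

section Dynamics

variable [TopologicalSpace X] [AddGroup X]

/-- Right-hand side of the ideal equation for `u_n(t)`, `t = m τ_n`, `n, m ≥ 1`:
`f(u_n(t - τ_n), u_{n+1}(t - τ_n))`, plus `g(u_{n-1}(t - 2 τ_n), u_n(t - 2 τ_n))` if `m` is even. -/
def idealRHS (f g : C(X × X, X)) (u : ℕ → ℕ → X) (n m : ℕ) : X :=
  if Even m then
    f (u n (m - 1), u (n + 1) (2 * (m - 1))) + g (u (n - 1) (m / 2 - 1), u n (m - 2))
  else
    f (u n (m - 1), u (n + 1) (2 * (m - 1)))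

/-- Weak solutions: fields on the lattice that satisfy the ideal equations at all lattice points,
with initial values `a` and boundary values `b`. -/
def IsWeakSolution (f g : C(X × X, X)) (a b : ℕ → X) (u : Lattice → X) : Prop :=
  ∀ n m : ℕ, 1 ≤ n → 1 ≤ m →
    extendField a b u n m = idealRHS f g (extendField a b u) n m

/-- The solution regularized at scale `N`, as a function of the noise `x = (x_0, x_1, …)`: the
value at `(n, m)` is `x_m` for `n = N + 1`, is `0` for `n > N + 1`, and is given by the ideal
equations with initial values `a` and boundary values `b` for `n ≤ N`. -/
def regField (f g : C(X × X, X)) (N : ℕ) (a b x : ℕ → X) (n m : ℕ) : X :=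
  if n = 0 then b m
  else if hN : N < n then
    if n = N + 1 then x m else 0
  else if hm : m = 0 then a (n - 1)
  else if hev : Even m then
    f (regField f g N a b x n (m - 1), regField f g N a b x (n + 1) (2 * (m - 1))) +
      g (regField f g N a b x (n - 1) (m / 2 - 1), regField f g N a b x n (m - 2))
  else
    f (regField f g N a b x n (m - 1), regField f g N a b x (n + 1) (2 * (m - 1)))
termination_by m * 2 ^ (N + 1 - n)
decreasing_by
  all_goals
    obtain ⟨d, rfl⟩ : ∃ d, N = n + d := ⟨N - n, by omega⟩
    try obtain ⟨j, rfl⟩ := hev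
  · rw [show n + d + 1 - n = d + 1 by omega]
    exact Nat.mul_lt_mul_of_pos_right (by omega) (by positivity)
  · rw [show n + d + 1 - n = d + 1 by omega, show n + d + 1 - (n + 1) = d by omega, pow_succ]
    have := Nat.pos_of_ne_zero (pow_ne_zero d (two_ne_zero (α := ℕ)))
    obtain ⟨i, rfl⟩ : ∃ i, j = i + 1 := ⟨j - 1, by omega⟩
    rw [show 2 * (i + 1 + (i + 1) - 1) = (2 * i + 1) * 2 by omega]
    nlinarith
  · rw [show n + d + 1 - n = d + 1 by omega, show n + d + 1 - (n - 1) = d + 2 by omega, pow_succ,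
      pow_succ]
    have := Nat.pos_of_ne_zero (pow_ne_zero d (two_ne_zero (α := ℕ)))
    obtain ⟨i, rfl⟩ : ∃ i, j = i + 1 := ⟨j - 1, by omega⟩
    rw [show (i + 1 + (i + 1)) / 2 - 1 = i by omega]
    nlinarith
  · rw [show n + d + 1 - n = d + 1 by omega]
    exact Nat.mul_lt_mul_of_pos_right (by omega) (by positivity)
  · rw [show n + d + 1 - n = d + 1 by omega]
    exact Nat.mul_lt_mul_of_pos_right (by omega) (by positivity)
  · rw [show n + d + 1 - n = d + 1 by omega, show n + d + 1 - (n + 1) = d by omega, pow_succ]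
    have := Nat.pos_of_ne_zero (pow_ne_zero d (two_ne_zero (α := ℕ)))
    obtain ⟨i, rfl⟩ : ∃ i, m = i + 1 := ⟨m - 1, by omega⟩
    rw [show 2 * (i + 1 - 1) = i * 2 by omega]
    nlinarith

lemma regField_zero (f g : C(X × X, X)) (N : ℕ) (a b x : ℕ → X) (m : ℕ) :
    regField f g N a b x 0 m = b m := by
  rw [regField]; simp

lemma regField_gt (f g : C(X × X, X)) (N : ℕ) (a b x : ℕ → X) {n : ℕ} (m : ℕ) (hn : N < n) :
    regField f g N a b x n m = if n = N + 1 then x m else 0 := by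
  rw [regField, if_neg (by omega), dif_pos hn]

lemma regField_init (f g : C(X × X, X)) (N : ℕ) (a b x : ℕ → X) {n : ℕ} (hn : 1 ≤ n)
    (hN : n ≤ N) : regField f g N a b x n 0 = a (n - 1) := by
  rw [regField, if_neg (by omega), dif_neg (by omega), dif_pos rfl]

/-- At scales `1 ≤ n ≤ N` the regularized solution satisfies the ideal equations. -/
lemma regField_eq (f g : C(X × X, X)) (N : ℕ) (a b x : ℕ → X) {n m : ℕ} (hn : 1 ≤ n)
    (hN : n ≤ N) (hm : 1 ≤ m) :
    regField f g N a b x n m = idealRHS f g (regField f g N a b x) n m := by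
  rw [regField, if_neg (by omega), dif_neg (by omega), dif_neg (by omega), idealRHS]
  split_ifs <;> rfl

/-- Up to time `τ_1` the regularized solution does not depend on the boundary values. -/
lemma regField_halfTime_boundary (f g : C(X × X, X)) (N : ℕ) (a b b' x : ℕ → X) (n m : ℕ)
    (hn : 1 ≤ n) (hm : 2 * m ≤ 2 ^ n) :
    regField f g N a b x n m = regField f g N a b' x n m := by
  induction n, m using regField.induct N with
  | case1 m => omega
  | case2 n hn0 hN => simp only [regField_gt f g N a _ x n hN]
  | case3 n m hn0 hN hne => simp only [regField_gt f g N a _ x m hN]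
  | case4 n hn0 hN => simp only [regField_init f g N a _ x hn (not_lt.mp hN)]
  | case5 n m hn0 hN hm0 hev ih1 ih2 ih3 ih4 =>
    obtain ⟨d, rfl⟩ : ∃ d, n = d + 1 := ⟨n - 1, by omega⟩
    obtain ⟨j, rfl⟩ := hev
    rw [pow_succ] at hm
    have hd : d ≠ 0 := by
      rintro rfl
      omega
    simp only [regField_eq f g N a _ x hn (not_lt.mp hN) (Nat.one_le_iff_ne_zero.mpr hm0),
      idealRHS, if_pos (Even.add_self j)]
    rw [ih1 hn (by rw [pow_succ]; omega), ih2 (by omega) (by rw [pow_succ, pow_succ]; omega),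
      ih3 (by omega) (by rw [Nat.add_sub_cancel]; omega), ih4 hn (by rw [pow_succ]; omega)]
  | case6 n m hn0 hN hm0 hev ih1 ih2 =>
    simp only [regField_eq f g N a _ x hn (not_lt.mp hN) (Nat.one_le_iff_ne_zero.mpr hm0),
      idealRHS, if_neg hev]
    rw [ih1 hn (by omega), ih2 (by omega) (by rw [pow_succ]; omega)]

end Dynamics

section Laws

variable [TopologicalSpace X] [SecondCountableTopology X] [MeasurableSpace X] [BorelSpace X]

/-- The deterministic kernel `a ↦ δ` at the `k`-fold shift of `a`. -/
def shiftUpKernel (X : Type*) [TopologicalSpace X] [MeasurableSpace X]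
    (k : ℕ) : Kernel (ℕ → X) (ℕ → X) :=
  Kernel.deterministic shiftUp^[k]
    (Measurable.iterate (measurable_pi_lambda _ fun j => measurable_pi_apply (j + 1)) k)

/-- The deterministic kernel of the shift `a ↦ (0, a_1, a_2, …)`. -/
def shiftDownKernel (X : Type*) [TopologicalSpace X] [SecondCountableTopology X]
    [MeasurableSpace X] [BorelSpace X] [Zero X] : Kernel (ℕ → X) (ℕ → X) :=
  Kernel.deterministic shiftDown continuous_shiftDown.measurable

/-- The deterministic kernel of the coupling map. -/
def couplingKernel [Zero X] (f g : C(X × X, X)) : Kernel (ℕ → X) (ℕ → X) :=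
  Kernel.deterministic (couplingMap f g) (continuous_couplingMap f g).measurable

/-- The deterministic kernel of the boundary map. -/
def boundaryKernel [Zero X] (g : C(X × X, X)) (b : X) : Kernel (ℕ → X) (ℕ → X) :=
  Kernel.deterministic (boundaryMap g b) (continuous_boundaryMap g b).measurable

/-- Convolution of kernels: given `a`, the law of the sum of independent variables with laws
`κ(· | a)` and `η(· | a)`. -/
def convKernel [Add X] (κ η : Kernel (ℕ → X) (ℕ → X)) : Kernel (ℕ → X) (ℕ → X) :=
  (κ ×ₖ η).map fun p => p.1 + p.2

variable [AddGroup X] [ContinuousAdd X]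

lemma measurable_add_seq : Measurable fun p : (ℕ → X) × (ℕ → X) => p.1 + p.2 :=
  (continuous_fst.add continuous_snd).measurable

instance (κ η : Kernel (ℕ → X) (ℕ → X)) [IsMarkovKernel κ] [IsMarkovKernel η] :
    IsMarkovKernel (convKernel κ η) :=
  Kernel.IsMarkovKernel.map _ measurable_add_seq

/-- Convolution with a deterministic kernel is the expected translation of measures. -/
lemma convKernel_deterministic_apply (κ : Kernel (ℕ → X) (ℕ → X)) [IsMarkovKernel κ]
    (h : (ℕ → X) → ℕ → X) (hh : Measurable h) (a : ℕ → X) {A : Set (ℕ → X)}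
    (hA : MeasurableSet A) :
    convKernel κ (Kernel.deterministic h hh) a A = κ a {u | u + h a ∈ A} := by
  have hm : MeasurableSet ((fun p : (ℕ → X) × (ℕ → X) => p.1 + p.2) ⁻¹' A) :=
    measurable_add_seq hA
  rw [convKernel, Kernel.map_apply' _ measurable_add_seq _ hA, Kernel.prod_apply,
    Measure.prod_apply_symm hm, Kernel.deterministic_apply,
    lintegral_dirac' _ (measurable_measure_prodMk_right hm)]
  rfl

/-- The stochastic renormalization group operator `Ψ ↦ (Σ₋ ∘ Ψ ∘ Ψ ∘ Σ₊) ∗ Ξ`. -/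
def stochasticRG (f g : C(X × X, X)) (Ψ : Kernel (ℕ → X) (ℕ → X)) : Kernel (ℕ → X) (ℕ → X) :=
  convKernel (shiftDownKernel X ∘ₖ Ψ ∘ₖ Ψ ∘ₖ shiftUpKernel X 1) (couplingKernel f g)

/-- The unit-time kernel `Φ_b = (Ψ ∘ Ψ) ∗ B_b`. -/
def unitTimeKernel (g : C(X × X, X)) (Ψ : Kernel (ℕ → X) (ℕ → X)) (b : X) :
    Kernel (ℕ → X) (ℕ → X) :=
  convKernel (Ψ ∘ₖ Ψ) (boundaryKernel g b)

instance (g : C(X × X, X)) (Ψ : Kernel (ℕ → X) (ℕ → X)) [IsMarkovKernel Ψ] (b : X) :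
    IsMarkovKernel (unitTimeKernel g Ψ b) := by
  unfold unitTimeKernel boundaryKernel
  infer_instance

/-- The kernel `P_t = Φ_{b_{t-1}} ∘ ⋯ ∘ Φ_{b_0}`, with `P_0` the identity kernel. -/
def integerTimeKernel (g : C(X × X, X)) (Ψ : Kernel (ℕ → X) (ℕ → X)) (b : ℕ → X) :
    ℕ → Kernel (ℕ → X) (ℕ → X)
  | 0 => Kernel.id
  | t + 1 => unitTimeKernel g Ψ (b t) ∘ₖ integerTimeKernel g Ψ b t

lemma measurable_regField (f g : C(X × X, X)) (N : ℕ) (b : ℕ → X) (n m : ℕ) :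
    Measurable fun p : (ℕ → X) × (ℕ → X) => regField f g N p.1 b p.2 n m := by
  have hf := f.continuous.measurable
  have hg := g.continuous.measurable
  induction n, m using regField.induct N with
  | case1 m => simp only [regField_zero]; exact measurable_const
  | case2 n hn hN =>
    simp only [regField_gt f g N _ b _ n hN, if_true]
    fun_prop
  | case3 n m hn hN hne =>
    simp only [regField_gt f g N _ b _ m hN, if_neg hne]
    exact measurable_const
  | case4 n hn hN =>
    simp only [regField_init f g N _ b _ (Nat.one_le_iff_ne_zero.mpr hn) (not_lt.mp hN)]
    fun_prop
  | case5 n m hn hN hm hev ih1 ih2 ih3 ih4 =>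
    simp only [regField_eq f g N _ b _ (Nat.one_le_iff_ne_zero.mpr hn) (not_lt.mp hN)
      (Nat.one_le_iff_ne_zero.mpr hm), idealRHS, if_pos hev]
    exact (hf.comp (ih1.prodMk ih2)).add (hg.comp (ih3.prodMk ih4))
  | case6 n m hn hN hm hev ih1 ih2 =>
    simp only [regField_eq f g N _ b _ (Nat.one_le_iff_ne_zero.mpr hn) (not_lt.mp hN)
      (Nat.one_le_iff_ne_zero.mpr hm), idealRHS, if_neg hev]
    exact hf.comp (ih1.prodMk ih2)

/-- The part of the regularized solution that lives on the lattice. -/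
def regSolution (f g : C(X × X, X)) (N : ℕ) (a b x : ℕ → X) : Lattice → X :=
  fun p => regField f g N a b x p.1.1 p.1.2

lemma measurable_regSolution (f g : C(X × X, X)) (N : ℕ) (a b : ℕ → X) :
    Measurable (regSolution f g N a b) :=
  measurable_pi_lambda _ fun p =>
    (measurable_regField f g N b p.1.1 p.1.2).comp measurable_prodMk_left

/-- The law on `Lattice → X` of the stochastically regularized solution: the noise variables
`x_0, x_1, …` are independent with law `μ`. -/
def solutionLaw (f g : C(X × X, X)) (μ : Measure X) [IsProbabilityMeasure μ] (N : ℕ)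
    (a b : ℕ → X) : ProbabilityMeasure (Lattice → X) :=
  ⟨(Measure.infinitePi fun _ : ℕ => μ).map (regSolution f g N a b),
    Measure.isProbabilityMeasure_map (measurable_regSolution f g N a b).aemeasurable⟩

/-- The half-time kernel `Ψ^(N)`: given `a`, the law of the stochastically regularized solution
`(u_1(τ_1), u_2(τ_1), …)` at time `τ_1 = 1/2` with initial values `a`. This state does not depend
on the boundary values (`regField_halfTime_boundary`), which are set to `0`. -/
def halfTimeKernel (f g : C(X × X, X)) (μ : Measure X) [IsProbabilityMeasure μ] (N : ℕ) :
    Kernel (ℕ → X) (ℕ → X) where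
  toFun a := (Measure.infinitePi fun _ : ℕ => μ).map
    fun x k => regField f g N a (fun _ => 0) x (k + 1) (2 ^ k)
  measurable' := by
    have h : Measurable fun p : (ℕ → X) × (ℕ → X) =>
        fun k => regField f g N p.1 (fun _ => 0) p.2 (k + 1) (2 ^ k) :=
      measurable_pi_lambda _ fun k => measurable_regField f g N _ (k + 1) (2 ^ k)
    have h2 := (Measure.measurable_map _ h).comp
      (Measurable.map_prodMk_left (ν := Measure.infinitePi fun _ : ℕ => μ))
    convert h2 using 2 with a
    exact (Measure.map_map h measurable_prodMk_left).symm

end Laws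

/-- Convergence of kernels on sequences: `∫ φ dΨ_N(· | a_N) → ∫ φ dΨ(· | a)` for all convergent
sequences `a_N → a` and all bounded uniformly continuous real functions `φ`, where `ℕ → X` has the
product uniformity. -/
def KernelTendsto [UniformSpace X] [MeasurableSpace X] (Ψs : ℕ → Kernel (ℕ → X) (ℕ → X))
    (Ψ : Kernel (ℕ → X) (ℕ → X)) : Prop :=
  ∀ (as : ℕ → ℕ → X) (a : ℕ → X), Tendsto as atTop (𝓝 a) →
    ∀ φ : (ℕ → X) → ℝ, UniformContinuous φ → (∃ C : ℝ, ∀ u, |φ u| ≤ C) →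
      Tendsto (fun N => ∫ u, φ u ∂(Ψs N (as N))) atTop (𝓝 (∫ u, φ u ∂(Ψ a)))

/-- `Z_0, Z_1, …` is a Markov chain under `P` that starts at the point `z` and has the transition
kernel `κ t` from time `t` to time `t + 1`: the conditional law of `Z_{t+1}` given
`(Z_0, …, Z_t)` is `κ t (Z_t)`. -/
def IsMarkovChain {Ω S : Type*} [MeasurableSpace Ω] [MeasurableSpace S] (P : Measure Ω)
    (Z : ℕ → Ω → S) (z : S) (κ : ℕ → Kernel S S) : Prop :=
  P.map (Z 0) = Measure.dirac z ∧
    ∀ t : ℕ, HasCondDistrib (Z (t + 1)) (fun ω (i : Fin (t + 1)) => Z i ω)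
      ((κ t).comap (fun h : Fin (t + 1) → S => h (Fin.last t)) (measurable_pi_apply _)) P

end SpontStoch

end

/-! The system is self-similar. Between the times `j τ_s` and `(j + 1) τ_s`, the scales beyond `s`
are a copy of the whole system over one unit of time, regularized at `M = N - s`, with `u_s(j τ_s)`
as boundary value (`regField_shift`, `regState_succ`). One unit of time is two half-time steps
driven by successive blocks of noise, plus a deterministic boundary term (`regField_unitTime`). As
the noise is i.i.d., the next state given the past has a law built from the half-time kernel of
order `M` alone (`map_prodMk_of_causal`, `map_regHistory_prodMk_regState`). The scales up to `s`
carry no further randomness: they are continuous functions of the path of scale `s + 1`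
(`regField_eq_of_path`). Hence this Markov description closes on the history of the states beyond
`s`.

The hypothesis on the half-time kernels is convergence along moving arguments. By the extended
continuous mapping theorem (`WeakTendsto.integral`) it survives composition, translation and the
formation of joint laws, so induction on time gives convergence of the history laws
(`exists_weakTendsto_regHistory`). Every finite set of lattice values is read off from one such
history; convergence of all finite-dimensional marginals, with tightness, produces the limit law.
Each ideal equation is a closed condition that holds surely for large `N`, so it holds almost surely
in the limit. The Markov and half-time identities are equalities of laws and pass to the limit as
well; `s = 0` gives the integer times.

One obstacle is that the state at a given time shows, at scale `N + 1`, a noise value that also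
drives the next step. `truncate` discards that entry, which makes past and future independent, and
it tends to the identity as `M` grows. -/

noncomputable section

namespace SpontStoch

/-! ### Weak convergence and kernels converging along moving arguments -/

section WeakConvergence

variable {S T U : Type*} [TopologicalSpace S] [MeasurableSpace S] [TopologicalSpace T]
  [MeasurableSpace T] [TopologicalSpace U] [MeasurableSpace U]

/-- Weak convergence of a sequence of measures. -/
def WeakTendsto (μs : ℕ → Measure S) (μ : Measure S) : Prop :=
  ∀ φ : BoundedContinuousFunction S ℝ,
    Tendsto (fun N => ∫ x, φ x ∂(μs N)) atTop (𝓝 (∫ x, φ x ∂μ))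

/-- Continuous convergence of a sequence of maps. -/
def ContTendsto {S T : Type*} [TopologicalSpace S] [TopologicalSpace T]
    (hs : ℕ → S → T) (h : S → T) : Prop :=
  ∀ (xs : ℕ → S) (x : S), Tendsto xs atTop (𝓝 x) →
    Tendsto (fun N => hs N (xs N)) atTop (𝓝 (h x))

/-- Continuous convergence of a sequence of kernels. -/
def KernelContTendsto (κs : ℕ → Kernel S T) (κ : Kernel S T) : Prop :=
  ∀ (xs : ℕ → S) (x : S), Tendsto xs atTop (𝓝 x) →
    WeakTendsto (fun N => κs N (xs N)) (κ x)

lemma weakTendsto_iff [OpensMeasurableSpace S] {μs : ℕ → ProbabilityMeasure S}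
    {μ : ProbabilityMeasure S} :
    WeakTendsto (fun N => (μs N : Measure S)) μ ↔ Tendsto μs atTop (𝓝 μ) :=
  ProbabilityMeasure.tendsto_iff_forall_integral_tendsto.symm

lemma WeakTendsto.unique [BorelSpace S] [HasOuterApproxClosed S] {μs : ℕ → Measure S}
    {μ ν : Measure S} [IsProbabilityMeasure μ] [IsProbabilityMeasure ν]
    (h : WeakTendsto μs μ) (h' : WeakTendsto μs ν) : μ = ν :=
  ext_of_forall_integral_eq_of_IsFiniteMeasure fun φ => tendsto_nhds_unique (h φ) (h' φ)

lemma WeakTendsto.congr' {μs νs : ℕ → Measure S} {μ : Measure S} (h : WeakTendsto μs μ)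
    (he : ∀ᶠ N in atTop, μs N = νs N) : WeakTendsto νs μ := fun φ =>
  (h φ).congr' <| he.mono fun N hN => by rw [hN]

lemma WeakTendsto.comp_tendsto {μs : ℕ → Measure S} {μ : Measure S} (h : WeakTendsto μs μ)
    {k : ℕ → ℕ} (hk : Tendsto k atTop atTop) : WeakTendsto (fun N => μs (k N)) μ := fun φ =>
  (h φ).comp hk

lemma weakTendsto_dirac [OpensMeasurableSpace S] {xs : ℕ → S} {x : S}
    (h : Tendsto xs atTop (𝓝 x)) :
    WeakTendsto (fun N => Measure.dirac (xs N)) (Measure.dirac x) := fun φ => by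
  have hm : StronglyMeasurable φ := φ.continuous.stronglyMeasurable
  simp only [integral_dirac' _ _ hm]
  exact (φ.continuous.tendsto x).comp h

lemma ContTendsto.of_continuous {S T : Type*} [TopologicalSpace S] [TopologicalSpace T]
    {h : S → T} (hh : Continuous h) : ContTendsto (fun _ => h) h :=
  fun _ x hx => (hh.tendsto x).comp hx

lemma ContTendsto.prodMk {S T U : Type*} [TopologicalSpace S] [TopologicalSpace T]
    [TopologicalSpace U] {hs : ℕ → S → T} {h : S → T} {ks : ℕ → S → U} {k : S → U}
    (hh : ContTendsto hs h) (hk : ContTendsto ks k) :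
    ContTendsto (fun N x => (hs N x, ks N x)) (fun x => (h x, k x)) :=
  fun xs x hx => (hh xs x hx).prodMk_nhds (hk xs x hx)

/-- First countability gives points `y k → x` and indices `r k → ∞` with `hs (r k) (y k) ∈ F`, and
continuous convergence then puts the limit in `F`. This is the pointwise input of the extended
continuous mapping theorem. -/
lemma ContTendsto.mem_of_forall_mem_closure {S T : Type*} [TopologicalSpace S]
    [FirstCountableTopology S] [TopologicalSpace T] {hs : ℕ → S → T} {h : S → T}
    (hh : ContTendsto hs h) {F : Set T} (hF : IsClosed F) {x : S}
    (hx : ∀ k : ℕ, x ∈ closure (⋃ N ≥ k, hs N ⁻¹' F)) : h x ∈ F := by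
  obtain ⟨B, hB⟩ := (𝓝 x).exists_antitone_basis
  have hfr : ∀ n : ℕ, ∃ᶠ k in atTop, ∃ y ∈ B n, hs k y ∈ F := by
    intro n
    rw [frequently_atTop]
    intro k
    obtain ⟨y, hyB, hy⟩ := mem_closure_iff_nhds.mp (hx k) (B n) (hB.1.mem_of_mem trivial)
    simp only [Set.mem_iUnion] at hy
    obtain ⟨N, hN, hy⟩ := hy
    exact ⟨N, hN, y, hyB, hy⟩
  obtain ⟨r, hr, hy⟩ := extraction_forall_of_frequently hfr
  choose y hyB hyF using hy
  -- Continuous convergence is stated for full sequences, so the indices missed by `r` are filled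
  -- with the constant `x`.
  have hxs : Tendsto (Function.extend r y fun _ => x) atTop (𝓝 x) := by
    rw [hB.1.tendsto_right_iff]
    intro n _
    filter_upwards [eventually_ge_atTop (r n)] with N hN
    by_cases hk : ∃ k, r k = N
    · obtain ⟨k, rfl⟩ := hk
      rw [hr.injective.extend_apply]
      exact hB.2 (hr.le_iff_le.mp hN) (hyB k)
    · rw [Function.extend_apply' _ _ _ hk]
      exact mem_of_mem_nhds (hB.1.mem_of_mem trivial)
  have hlim := (hh _ x hxs).comp hr.tendsto_atTop
  refine hF.mem_of_tendsto hlim (Eventually.of_forall fun k => ?_)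
  simp only [Function.comp, hr.injective.extend_apply]
  exact hyF k

/-- The extended continuous mapping theorem, for integrals of real functions. -/
lemma WeakTendsto.integral [FirstCountableTopology S] [OpensMeasurableSpace S]
    [HasOuterApproxClosed S] {μs : ℕ → Measure S} {μ : Measure S}
    [∀ N, IsProbabilityMeasure (μs N)] [IsProbabilityMeasure μ] (hμ : WeakTendsto μs μ)
    {hs : ℕ → S → ℝ} {h : S → ℝ} (hh : ContTendsto hs h) (hms : ∀ N, Measurable (hs N))
    (hm : Measurable h) {C : ℝ} (hC : ∀ N x, |hs N x| ≤ C) :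
    Tendsto (fun N => ∫ x, hs N x ∂(μs N)) atTop (𝓝 (∫ x, h x ∂μ)) := by
  have hCh : ∀ x, |h x| ≤ C := fun x =>
    le_of_tendsto (hh (fun _ => x) x tendsto_const_nhds).abs (Eventually.of_forall fun N => hC N x)
  let Ps : ℕ → ProbabilityMeasure S := fun N => ⟨μs N, inferInstance⟩
  let P : ProbabilityMeasure S := ⟨μ, inferInstance⟩
  have hP : Tendsto Ps atTop (𝓝 P) := weakTendsto_iff.mp hμ
  have hmap : Tendsto (fun N => (Ps N).map (hms N).aemeasurable) atTop
      (𝓝 (P.map hm.aemeasurable)) := by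
    refine tendsto_of_forall_isClosed_limsup_le' fun F hF => ?_
    simp only [ProbabilityMeasure.toMeasure_map, Measure.map_apply (hms _) hF.measurableSet,
      Measure.map_apply hm hF.measurableSet]
    -- Portmanteau for varying maps: the closed sets `G k` contain all preimages of `F` with index
    -- at least `k`, and they decrease to a set on which `h` takes values in `F`.
    let G : ℕ → Set S := fun k => closure (⋃ N ≥ k, hs N ⁻¹' F)
    have hG : ∀ k, limsup (fun N => (Ps N : Measure S) (hs N ⁻¹' F)) atTop ≤ μ (G k) := by
      intro k
      refine le_trans (limsup_le_limsup ?_) (ProbabilityMeasure.limsup_measure_closed_le_of_tendsto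
        hP (isClosed_closure : IsClosed (G k)))
      filter_upwards [eventually_ge_atTop k] with N hN
      exact measure_mono fun y hy => subset_closure (Set.mem_iUnion₂.mpr ⟨N, hN, hy⟩)
    have hanti : Antitone G := fun k l hkl => closure_mono
      (Set.biUnion_mono (fun N (hN : N ≥ l) => le_trans hkl hN) fun _ _ => subset_rfl)
    have hlim := tendsto_measure_iInter_atTop (μ := μ)
      (fun k => (isClosed_closure : IsClosed (G k)).measurableSet.nullMeasurableSet) hanti
      ⟨0, measure_ne_top _ _⟩
    refine le_trans (ge_of_tendsto hlim (Eventually.of_forall hG)) (measure_mono fun x hx => ?_)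
    exact hh.mem_of_forall_mem_closure hF fun k => Set.mem_iInter.mp hx k
  -- The identity of `ℝ` is not a bounded test function; clamping to `[-C, C]` changes none of the
  -- values that occur.
  let ψ : BoundedContinuousFunction ℝ ℝ :=
    BoundedContinuousFunction.ofNormedAddCommGroup (fun y => max (-C) (min C y))
      (by fun_prop) |C| fun y => by
        rw [Real.norm_eq_abs]
        have hC0 : 0 ≤ C := by
          obtain ⟨x⟩ := P.nonempty
          exact (abs_nonneg _).trans (hCh x)
        rw [abs_of_nonneg hC0, abs_le]
        exact ⟨le_max_left _ _, max_le (by linarith) (min_le_left _ _)⟩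
  have hψ : ∀ y, |y| ≤ C → ψ y = y := fun y hy => by
    change max (-C) (min C y) = y
    rw [abs_le] at hy
    rw [min_eq_right hy.2, max_eq_right hy.1]
  have hfin := ProbabilityMeasure.tendsto_iff_forall_integral_tendsto.mp hmap ψ
  simp only [ProbabilityMeasure.toMeasure_map] at hfin
  rw [integral_map hm.aemeasurable ψ.continuous.aestronglyMeasurable] at hfin
  simp only [integral_map (hms _).aemeasurable ψ.continuous.aestronglyMeasurable] at hfin
  simpa only [hψ _ (hC _ _), hψ _ (hCh _)] using! hfin

lemma WeakTendsto.map [FirstCountableTopology S] [OpensMeasurableSpace S]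
    [HasOuterApproxClosed S] [OpensMeasurableSpace T] {μs : ℕ → Measure S} {μ : Measure S}
    [∀ N, IsProbabilityMeasure (μs N)] [IsProbabilityMeasure μ] (hμ : WeakTendsto μs μ)
    {hs : ℕ → S → T} {h : S → T} (hh : ContTendsto hs h) (hms : ∀ N, Measurable (hs N))
    (hm : Measurable h) :
    WeakTendsto (fun N => (μs N).map (hs N)) (μ.map h) := fun φ => by
  rw [integral_map hm.aemeasurable φ.continuous.aestronglyMeasurable]
  simp only [integral_map (hms _).aemeasurable φ.continuous.aestronglyMeasurable]
  exact hμ.integral (fun xs x hx => (φ.continuous.tendsto _).comp (hh xs x hx))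
    (fun N => φ.continuous.measurable.comp (hms N)) (φ.continuous.measurable.comp hm)
    fun N x => φ.norm_coe_le_norm _

/-- By Fubini the integral of `φ` is an iterated one. The inner integrals converge continuously in
the first variable, so `WeakTendsto.integral` applies twice: inside along `κs N (xs N)`, and outside
along `μs N`. -/
lemma WeakTendsto.compProd [FirstCountableTopology S] [OpensMeasurableSpace S]
    [HasOuterApproxClosed S] [FirstCountableTopology T] [OpensMeasurableSpace T]
    [HasOuterApproxClosed T] [OpensMeasurableSpace (S × T)] {μs : ℕ → Measure S} {μ : Measure S}
    [∀ N, IsProbabilityMeasure (μs N)] [IsProbabilityMeasure μ] (hμ : WeakTendsto μs μ)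
    {κs : ℕ → Kernel S T} {κ : Kernel S T} [∀ N, IsMarkovKernel (κs N)] [IsMarkovKernel κ]
    (hκ : KernelContTendsto κs κ) :
    WeakTendsto (fun N => μs N ⊗ₘ κs N) (μ ⊗ₘ κ) := fun φ => by
  have hφ : StronglyMeasurable φ := φ.continuous.stronglyMeasurable
  have hint : ∀ (ν : Measure (S × T)) [IsProbabilityMeasure ν], Integrable φ ν := fun ν _ =>
    φ.integrable ν
  simp only [Measure.integral_compProd (hint _)]
  refine hμ.integral (C := ‖φ‖) (fun xs x hx => ?_)
    (fun N => (hφ.integral_kernel_prod_right' (κ := κs N)).measurable)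
    (hφ.integral_kernel_prod_right' (κ := κ)).measurable fun N x => ?_
  · refine (hκ xs x hx).integral (C := ‖φ‖) (fun ys y hy => ?_) (fun N => ?_) ?_
      fun N y => φ.norm_coe_le_norm _
    · exact (φ.continuous.tendsto _).comp (hx.prodMk_nhds hy)
    · exact (φ.continuous.comp (by fun_prop : Continuous fun y => (xs N, y))).measurable
    · exact (φ.continuous.comp (by fun_prop : Continuous fun y => (x, y))).measurable
  · refine (norm_integral_le_of_norm_le_const (C := ‖φ‖)
      (Eventually.of_forall fun y => φ.norm_coe_le_norm _)).trans ?_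
    simp

lemma WeakTendsto.bind [FirstCountableTopology S] [OpensMeasurableSpace S]
    [HasOuterApproxClosed S] [FirstCountableTopology T] [OpensMeasurableSpace T]
    [HasOuterApproxClosed T] [OpensMeasurableSpace (S × T)] [HasOuterApproxClosed (S × T)]
    {μs : ℕ → Measure S} {μ : Measure S}
    [∀ N, IsProbabilityMeasure (μs N)] [IsProbabilityMeasure μ] (hμ : WeakTendsto μs μ)
    {κs : ℕ → Kernel S T} {κ : Kernel S T} [∀ N, IsMarkovKernel (κs N)] [IsMarkovKernel κ]
    (hκ : KernelContTendsto κs κ) :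
    WeakTendsto (fun N => κs N ∘ₘ μs N) (κ ∘ₘ μ) := by
  simp only [← Measure.snd_compProd]
  exact (hμ.compProd hκ).map (ContTendsto.of_continuous continuous_snd)
    (fun _ => measurable_snd) measurable_snd

lemma KernelContTendsto.comp [FirstCountableTopology U] [OpensMeasurableSpace U]
    [HasOuterApproxClosed U] [FirstCountableTopology T] [OpensMeasurableSpace T]
    [HasOuterApproxClosed T] [OpensMeasurableSpace (U × T)] [HasOuterApproxClosed (U × T)]
    {κs : ℕ → Kernel U T} {κ : Kernel U T} [∀ N, IsMarkovKernel (κs N)] [IsMarkovKernel κ]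
    {ηs : ℕ → Kernel S U} {η : Kernel S U} [∀ N, IsMarkovKernel (ηs N)] [IsMarkovKernel η]
    (hκ : KernelContTendsto κs κ) (hη : KernelContTendsto ηs η) :
    KernelContTendsto (fun N => κs N ∘ₖ ηs N) (κ ∘ₖ η) := fun xs x hx => by
  simp only [Kernel.comp_apply]
  exact (hη xs x hx).bind hκ

lemma KernelContTendsto.comap {κs : ℕ → Kernel U T} {κ : Kernel U T} {h : S → U}
    (hκ : KernelContTendsto κs κ) (hh : Continuous h) (hm : Measurable h) :
    KernelContTendsto (fun N => (κs N).comap h hm) (κ.comap h hm) := fun xs x hx => by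
  simp only [Kernel.comap_apply]
  exact hκ _ _ ((hh.tendsto x).comp hx)

end WeakConvergence

/-! ### Causality and self-similarity of the regularized solution -/

section RegularizedField

variable {X : Type*} [TopologicalSpace X] [AddGroup X]

/-- The regularized solution at `(n, m)` depends on the initial values at scales up to `N`, on the
noise at even positions before the given time, and on the boundary values that have entered. -/
lemma regField_congr (f g : C(X × X, X)) (N : ℕ) {a a' b b' x x' : ℕ → X} (n m : ℕ) (hn : n ≤ N)
    (ha : ∀ k < N, a k = a' k) (hx : ∀ j < m * 2 ^ (N - n), x (2 * j) = x' (2 * j))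
    (hb : ∀ j, j * 2 ^ n + (if n = 0 then 0 else 2 ^ n) ≤ m → b j = b' j) :
    regField f g N a b x n m = regField f g N a' b' x' n m := by
  -- The neighbour at scale `n + 1` is noise when `n = N` and is covered by induction otherwise. The
  -- equations read it at position `2 * (m - 1)`, which is why only even noise positions matter.
  have key : ∀ n m : ℕ, 1 ≤ n → n ≤ N → 1 ≤ m →
      (∀ j < m * 2 ^ (N - n), x (2 * j) = x' (2 * j)) →
      (n + 1 ≤ N → (∀ j < 2 * (m - 1) * 2 ^ (N - (n + 1)), x (2 * j) = x' (2 * j)) →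
        regField f g N a b x (n + 1) (2 * (m - 1)) =
          regField f g N a' b' x' (n + 1) (2 * (m - 1))) →
      regField f g N a b x (n + 1) (2 * (m - 1)) =
        regField f g N a' b' x' (n + 1) (2 * (m - 1)) := by
    intro n m hn hN hm hx h
    rcases hN.eq_or_lt with rfl | hlt
    · rw [regField_gt _ _ _ _ _ _ _ (Nat.lt_succ_self n),
        regField_gt _ _ _ _ _ _ _ (Nat.lt_succ_self n), if_pos rfl, if_pos rfl]
      exact hx _ (by simp; omega)
    · refine h hlt fun j hj => hx j (hj.trans_le ?_)
      rw [show N - n = N - (n + 1) + 1 by omega, pow_succ]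
      calc 2 * (m - 1) * 2 ^ (N - (n + 1)) ≤ 2 * m * 2 ^ (N - (n + 1)) := by gcongr; omega
        _ = _ := by ring
  induction n, m using regField.induct N with
  | case1 m =>
    rw [regField_zero, regField_zero]
    exact hb m (by simp)
  | case2 n hn0 hN => omega
  | case3 n m hn0 hN hne => omega
  | case4 n hn0 hN =>
    rw [regField_init _ _ _ _ _ _ (Nat.one_le_iff_ne_zero.mpr hn0) hn,
      regField_init _ _ _ _ _ _ (Nat.one_le_iff_ne_zero.mpr hn0) hn]
    exact ha _ (by omega)
  | case5 n m hn0 hN hm0 hev ih1 ih2 ih3 ih4 =>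
    have h1n : 1 ≤ n := Nat.one_le_iff_ne_zero.mpr hn0
    have h1m : 1 ≤ m := Nat.one_le_iff_ne_zero.mpr hm0
    rw [if_neg hn0] at hb
    rw [regField_eq _ _ _ _ _ _ h1n hn h1m, regField_eq _ _ _ _ _ _ h1n hn h1m, idealRHS,
      idealRHS, if_pos hev, if_pos hev]
    rw [if_neg hn0] at ih1 ih4
    rw [if_neg (Nat.succ_ne_zero n)] at ih2
    obtain ⟨i, rfl⟩ := hev
    have hdiv : (i + i) / 2 = i := by omega
    rw [hdiv] at ih3 ⊢
    have hle : ∀ m' ≤ i + i, m' * 2 ^ (N - n) ≤ (i + i) * 2 ^ (N - n) := fun m' h =>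
      Nat.mul_le_mul_right _ h
    rw [ih1 hn (fun j hj => hx j (hj.trans_le (hle _ (by omega))))
        (fun j hj => hb j (by omega)),
      key n (i + i) h1n hn h1m hx (fun h h' => ih2 h h' fun j hj => hb j (by
        rw [pow_succ, ← mul_assoc, ← add_mul] at hj; omega)),
      ih4 hn (fun j hj => hx j (hj.trans_le (hle _ (by omega))))
        (fun j hj => hb j (by omega)),
      ih3 (by omega) (fun j hj => hx j (hj.trans_le ?_)) fun j hj => hb j ?_]
    · rw [show N - (n - 1) = N - n + 1 by omega, pow_succ]
      calc (i - 1) * (2 ^ (N - n) * 2) ≤ i * (2 ^ (N - n) * 2) := by gcongr; omega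
        _ = _ := by ring
    · obtain ⟨d, rfl⟩ : ∃ d, n = d + 1 := ⟨n - 1, by omega⟩
      rw [pow_succ, ← mul_assoc, ← add_mul]
      rw [Nat.add_sub_cancel] at hj
      rcases Nat.eq_zero_or_pos d with rfl | hd
      · simp at hj ⊢; omega
      · rw [if_neg (by omega)] at hj; omega
  | case6 n m hn0 hN hm0 hev ih1 ih2 =>
    have h1n : 1 ≤ n := Nat.one_le_iff_ne_zero.mpr hn0
    have h1m : 1 ≤ m := Nat.one_le_iff_ne_zero.mpr hm0
    rw [if_neg hn0] at hb
    rw [regField_eq _ _ _ _ _ _ h1n hn h1m, regField_eq _ _ _ _ _ _ h1n hn h1m, idealRHS,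
      idealRHS, if_neg hev, if_neg hev]
    rw [if_neg hn0] at ih1
    rw [if_neg (Nat.succ_ne_zero n)] at ih2
    rw [ih1 hn (fun j hj => hx j (hj.trans_le (Nat.mul_le_mul_right _ (by omega))))
        (fun j hj => hb j (by omega)),
      key n m h1n hn h1m hx (fun h h' => ih2 h h' fun j hj => hb j (by
        rw [pow_succ, ← mul_assoc, ← add_mul] at hj; omega))]

lemma regField_congr_init (f g : C(X × X, X)) (N : ℕ) {a a' : ℕ → X} (b x : ℕ → X) (n m : ℕ)
    (ha : ∀ k < N, a k = a' k) : regField f g N a b x n m = regField f g N a' b x n m := by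
  rcases le_or_gt n N with hn | hn
  · exact regField_congr f g N n m hn ha (fun _ _ => rfl) fun _ _ => rfl
  · rw [regField_gt _ _ _ _ _ _ _ hn, regField_gt _ _ _ _ _ _ _ hn]

/-- The state `(u_{s+1}(t), u_{s+2}(t), …)` of the regularized solution at time `t = j τ_s`. -/
def regState (f g : C(X × X, X)) (N : ℕ) (a b : ℕ → X) (s j : ℕ) (x : ℕ → X) : ℕ → X :=
  fun k => regField f g N a b x (s + k + 1) (j * 2 ^ (k + 1))

/-- Scales beyond `s`, started at time `j τ_s`, form a regularized solution with boundary values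
given by scale `s`. -/
lemma regField_shift (f g : C(X × X, X)) (s M : ℕ) (a b x : ℕ → X) (j n m : ℕ) :
    regField f g (s + M) a b x (s + n) (m + j * 2 ^ n) =
      regField f g M (regState f g (s + M) a b s j x)
        (fun i => regField f g (s + M) a b x s (i + j)) (fun i => x (i + j * 2 ^ (M + 1))) n m := by
  induction n, m using regField.induct M with
  | case1 m => rw [regField_zero]; simp
  | case2 m hn0 hN =>
    rw [regField_gt _ _ _ _ _ _ _ hN, regField_gt _ _ _ _ _ _ _ (by omega), if_pos rfl,
      if_pos (by omega)]
  | case3 n m hn0 hN hne =>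
    rw [regField_gt _ _ _ _ _ _ _ hN, regField_gt _ _ _ _ _ _ _ (by omega), if_neg hne,
      if_neg (by omega)]
  | case4 n hn0 hN =>
    rw [regField_init _ _ _ _ _ _ (by omega) (by omega), regState, zero_add,
      show s + (n - 1) + 1 = s + n by omega, show n - 1 + 1 = n by omega]
  | case5 n m hn0 hN hm0 hev ih1 ih2 ih3 ih4 =>
    obtain ⟨d, rfl⟩ : ∃ d, n = d + 1 := ⟨n - 1, by omega⟩
    obtain ⟨i, rfl⟩ : ∃ i, m = 2 * i + 2 := by
      obtain ⟨i, rfl⟩ := hev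
      exact ⟨i - 1, by omega⟩
    -- A shift by `j τ_s` is an even number of steps at every scale beyond `s`, so it preserves the
    -- branch of the equation.
    have hev' : Even (2 * i + 2 + j * 2 ^ (d + 1)) := ⟨i + 1 + j * 2 ^ d, by ring⟩
    rw [regField_eq _ _ _ _ _ _ (by omega) (by omega) (by omega),
      regField_eq _ _ _ _ _ _ (by omega) (by omega) (by omega), idealRHS, idealRHS,
      if_pos hev, if_pos hev']
    rw [← ih1, ← ih2, ← ih3, ← ih4]
    have e1 : 2 * i + 2 + j * 2 ^ (d + 1) - 1 = 2 * i + 2 - 1 + j * 2 ^ (d + 1) := by omega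
    have e2 : 2 * (2 * i + 2 + j * 2 ^ (d + 1) - 1) =
        2 * (2 * i + 2 - 1) + j * 2 ^ (d + 1 + 1) := by
      rw [e1, pow_succ _ (d + 1)]; ring
    have e3 : (2 * i + 2 + j * 2 ^ (d + 1)) / 2 - 1 = (2 * i + 2) / 2 - 1 + j * 2 ^ (d + 1 - 1) := by
      rw [pow_succ, ← mul_assoc, Nat.add_sub_cancel]; omega
    have e4 : 2 * i + 2 + j * 2 ^ (d + 1) - 2 = 2 * i + 2 - 2 + j * 2 ^ (d + 1) := by omega
    rw [e2, e3, e4, e1]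
    rfl
  | case6 n m hn0 hN hm0 hev ih1 ih2 =>
    obtain ⟨d, rfl⟩ : ∃ d, n = d + 1 := ⟨n - 1, by omega⟩
    have hev' : ¬ Even (m + j * 2 ^ (d + 1)) := by
      rw [Nat.even_add]
      have : Even (j * 2 ^ (d + 1)) := ⟨j * 2 ^ d, by ring⟩
      tauto
    rw [regField_eq _ _ _ _ _ _ (by omega) (by omega) (by omega),
      regField_eq _ _ _ _ _ _ (by omega) (by omega) (by omega), idealRHS, idealRHS,
      if_neg hev, if_neg hev']
    rw [← ih1, ← ih2]
    have e1 : m + j * 2 ^ (d + 1) - 1 = m - 1 + j * 2 ^ (d + 1) := by omega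
    have e2 : 2 * (m + j * 2 ^ (d + 1) - 1) = 2 * (m - 1) + j * 2 ^ (d + 1 + 1) := by
      rw [e1, pow_succ _ (d + 1)]; ring
    rw [e2, e1]
    rfl

/-- Scales up to `K` form a solution regularized at `K`, with scale `K + 1` as its noise. -/
lemma regField_coarse (f g : C(X × X, X)) {K N : ℕ} (hK : K ≤ N) (a b x : ℕ → X) (n m : ℕ)
    (hn : n ≤ K + 1) :
    regField f g N a b x n m =
      regField f g K a b (fun i => regField f g N a b x (K + 1) i) n m := by
  induction n, m using regField.induct K with
  | case1 m => rw [regField_zero, regField_zero]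
  | case2 m hn0 hN => rw [regField_gt f g K _ _ _ _ hN, if_pos rfl]
  | case3 n m hn0 hN hne => omega
  | case4 n hn0 hN =>
    rw [regField_init _ _ _ _ _ _ (by omega) (by omega),
      regField_init _ _ _ _ _ _ (by omega) (by omega)]
  | case5 n m hn0 hN hm0 hev ih1 ih2 ih3 ih4 =>
    rw [regField_eq f g N _ _ _ (by omega) (by omega) (by omega),
      regField_eq f g K _ _ _ (by omega) (by omega) (by omega), idealRHS, idealRHS,
      if_pos hev, if_pos hev, ih1 hn, ih2 (by omega), ih3 (by omega), ih4 hn]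
  | case6 n m hn0 hN hm0 hev ih1 ih2 =>
    rw [regField_eq f g N _ _ _ (by omega) (by omega) (by omega),
      regField_eq f g K _ _ _ (by omega) (by omega) (by omega), idealRHS, idealRHS,
      if_neg hev, if_neg hev, ih1 hn, ih2 (by omega)]

lemma continuous_regField_noise [ContinuousAdd X] (f g : C(X × X, X)) (N : ℕ) (a b : ℕ → X)
    (n m : ℕ) : Continuous fun x : ℕ → X => regField f g N a b x n m := by
  induction n, m using regField.induct N with
  | case1 m => simp only [regField_zero]; exact continuous_const
  | case2 n hn hN =>
    simp only [regField_gt f g N _ b _ n hN, if_true]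
    fun_prop
  | case3 n m hn hN hne =>
    simp only [regField_gt f g N _ b _ m hN, if_neg hne]
    exact continuous_const
  | case4 n hn hN =>
    simp only [regField_init f g N _ b _ (Nat.one_le_iff_ne_zero.mpr hn) (not_lt.mp hN)]
    fun_prop
  | case5 n m hn hN hm hev ih1 ih2 ih3 ih4 =>
    simp only [regField_eq f g N _ b _ (Nat.one_le_iff_ne_zero.mpr hn) (not_lt.mp hN)
      (Nat.one_le_iff_ne_zero.mpr hm), idealRHS, if_pos hev]
    exact (f.continuous.comp (ih1.prodMk ih2)).add (g.continuous.comp (ih3.prodMk ih4))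
  | case6 n m hn hN hm hev ih1 ih2 =>
    simp only [regField_eq f g N _ b _ (Nat.one_le_iff_ne_zero.mpr hn) (not_lt.mp hN)
      (Nat.one_le_iff_ne_zero.mpr hm), idealRHS, if_neg hev]
    exact f.continuous.comp (ih1.prodMk ih2)

/-- The regularized state at time `τ_1`, with zero boundary values. -/
def regHalf (f g : C(X × X, X)) (M : ℕ) (a x : ℕ → X) : ℕ → X :=
  fun k => regField f g M a (fun _ => 0) x (k + 1) (2 ^ k)

lemma regHalf_congr (f g : C(X × X, X)) (M : ℕ) {a a' : ℕ → X} (x : ℕ → X)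
    (ha : ∀ k < M, a k = a' k) : regHalf f g M a x = regHalf f g M a' x :=
  funext fun _ => regField_congr_init f g M _ x _ _ ha

lemma regField_eq_regHalf (f g : C(X × X, X)) (M : ℕ) (a b x : ℕ → X) (k : ℕ) :
    regField f g M a b x (k + 1) (2 ^ k) = regHalf f g M a x k :=
  regField_halfTime_boundary f g M a b _ x (k + 1) (2 ^ k) (by omega) (by rw [pow_succ]; omega)

/-- The state after unit time consists of two half-time steps and a boundary contribution. -/
lemma regField_unitTime (f g : C(X × X, X)) (M : ℕ) (hM : 1 ≤ M) (a b x : ℕ → X) (k : ℕ) :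
    regField f g M a b x (k + 1) (2 ^ (k + 1)) =
      regHalf f g M (regHalf f g M a x) (fun i => x (i + 2 ^ M)) k +
        boundaryMap g (b 0) a k := by
  obtain ⟨L, rfl⟩ : ∃ L, M = 1 + L := ⟨M - 1, by omega⟩
  -- Only scale 1 receives the boundary term: the restarted second half-step reaches it at an odd
  -- position, where `g` is absent. The finer scales over each half unit are again a copy of the
  -- system, seen from scale 1.
  rcases k with _ | k
  · have hhalf := regField_eq_regHalf f g (1 + L) a b x 0
    have hhalf' := regField_eq_regHalf f g (1 + L) a b x 1
    simp only [zero_add, pow_zero, pow_one, Nat.reduceAdd] at hhalf hhalf'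
    rw [regHalf]
    simp only [zero_add, pow_one, pow_zero, boundaryMap]
    rw [regField_eq f g _ a _ _ le_rfl hM (by omega : 1 ≤ 2), idealRHS, if_pos even_two,
      regField_eq f g _ (regHalf f g (1 + L) a x) _ _ le_rfl hM le_rfl, idealRHS, if_neg (by simp)]
    simp only [Nat.reduceSub, Nat.reduceAdd, Nat.reduceMul, Nat.reduceDiv, mul_zero]
    rw [regField_zero, regField_init _ _ _ _ _ _ le_rfl hM, regField_init _ _ _ _ _ _ le_rfl hM,
      hhalf, Nat.sub_self]
    -- For `L = 0` scale 2 is the noise itself, and both sides read `x 2`.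
    rcases Nat.eq_zero_or_pos L with rfl | hL
    · rw [regField_gt _ _ _ _ _ _ _ (by omega), regField_gt _ _ _ _ _ _ _ (by omega), if_pos rfl,
        if_pos rfl]
      rfl
    · rw [regField_init _ _ _ _ _ _ (by omega : 1 ≤ 2) (by omega), hhalf']
  · have h1 := regField_shift f g 1 L a b x 1 (k + 1) (2 ^ (k + 1))
    have h2 := regField_shift f g 1 L (regHalf f g (1 + L) a x) (fun _ => 0)
      (fun i => x (i + 2 ^ (1 + L))) 0 (k + 1) (2 ^ (k + 1))
    rw [show 2 ^ (k + 1) + 1 * 2 ^ (k + 1) = 2 ^ (k + 1 + 1) by ring,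
      show 1 + (k + 1) = k + 1 + 1 by ring] at h1
    rw [zero_mul, add_zero, show 1 + (k + 1) = k + 1 + 1 by ring] at h2
    rw [boundaryMap, add_zero, h1]
    conv_rhs => rw [regHalf, h2]
    rcases le_or_gt (k + 1) L with hk | hk
    · refine regField_congr f g L _ _ hk (fun i hi => ?_) (fun i _ => ?_) fun i hi => ?_
      · rw [regState, regState, zero_mul, regField_init _ _ _ _ _ _ (by omega) (by omega),
          ← regField_eq_regHalf f g (1 + L) a b x, one_mul, Nat.add_sub_cancel,
          Nat.add_comm 1 i]
      · simp [Nat.add_comm]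
      -- Within this span only the boundary value at index 0 can enter, and it is the value of scale
      -- 1 at time `τ_1` on both sides.
      · rw [if_neg (by omega)] at hi
        have h0 : i = 0 := by
          by_contra h
          have := Nat.mul_le_mul_right (2 ^ (k + 1)) (Nat.one_le_iff_ne_zero.mpr h)
          have := Nat.pos_of_ne_zero (pow_ne_zero (k + 1) (two_ne_zero (α := ℕ)))
          omega
        subst h0
        rw [regField_init _ _ _ _ _ _ le_rfl hM]
        simpa using regField_eq_regHalf f g (1 + L) a b x 0
    · rw [regField_gt _ _ _ _ _ _ _ hk, regField_gt _ _ _ _ _ _ _ hk]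
      simp [Nat.add_comm]

/-- One step of length `τ_s` of the scales beyond `s`. -/
lemma regState_succ (f g : C(X × X, X)) (s M : ℕ) (hM : 1 ≤ M) (a b x : ℕ → X) (j : ℕ) :
    regState f g (s + M) a b s (j + 1) x =
      regHalf f g M (regHalf f g M (regState f g (s + M) a b s j x)
          fun i => x (i + j * 2 ^ (M + 1)))
        (fun i => x (i + 2 ^ M + j * 2 ^ (M + 1))) +
      boundaryMap g (regField f g (s + M) a b x s j) (regState f g (s + M) a b s j x) := by
  funext k
  have h := regField_shift f g s M a b x j (k + 1) (2 ^ (k + 1))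
  rw [regField_unitTime f g M hM, zero_add] at h
  rw [regState, show (j + 1) * 2 ^ (k + 1) = 2 ^ (k + 1) + j * 2 ^ (k + 1) by ring, add_assoc s, h]
  rfl

/-- The state on the scales beyond `s` at time `j τ_s + τ_{s+1}`. -/
lemma regField_halfTime_shift (f g : C(X × X, X)) (s M : ℕ) (a b x : ℕ → X) (j k : ℕ) :
    regField f g (s + M) a b x (s + k + 1) ((2 * j + 1) * 2 ^ k) =
      regHalf f g M (regState f g (s + M) a b s j x) (fun i => x (i + j * 2 ^ (M + 1))) k := by
  rw [← regField_eq_regHalf f g M _ (fun i => regField f g (s + M) a b x s (i + j)),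
    ← regField_shift]
  congr 1
  ring

/-- The scales `n ≤ K` as a function of the path of scale `K + 1`. -/
lemma regField_eq_of_path (f g : C(X × X, X)) {K N : ℕ} (hK : K ≤ N) (a b x : ℕ → X)
    (h : ℕ → ℕ → X) (n m : ℕ) (hn : n ≤ K)
    (hh : ∀ j < m * 2 ^ (K - n), h j 0 = regState f g N a b K j x 0) :
    regField f g N a b x n m = regField f g K a b (fun i => h (i / 2) 0) n m := by
  rw [regField_coarse f g hK a b x n m (by omega)]
  refine regField_congr f g K n m hn (fun _ _ => rfl) (fun j hj => ?_) fun _ _ => rfl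
  rw [show 2 * j / 2 = j by omega, hh j hj, regState, zero_add, pow_one, add_zero, mul_comm]

end RegularizedField

/-! ### Truncation of sequences -/

section Truncation

variable {X : Type*} [Zero X]

/-- Keep the first `M` entries of a sequence. -/
def truncate (M : ℕ) (a : ℕ → X) : ℕ → X := fun k => if k < M then a k else 0

lemma continuous_truncate [TopologicalSpace X] (M : ℕ) : Continuous (truncate M : (ℕ → X) → ℕ → X) := by
  refine continuous_pi fun k => ?_
  unfold truncate
  split_ifs
  · exact continuous_apply k
  · exact continuous_const

lemma truncate_of_lt {M k : ℕ} (hk : k < M) (a : ℕ → X) : truncate M a k = a k := if_pos hk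

lemma contTendsto_truncate [TopologicalSpace X] : ContTendsto (truncate : ℕ → (ℕ → X) → ℕ → X) id := by
  intro xs x hx
  rw [tendsto_pi_nhds] at hx ⊢
  intro k
  refine (hx k).congr' ?_
  filter_upwards [eventually_gt_atTop k] with N hN
  rw [truncate_of_lt hN]

end Truncation

/-! ### Independence of past and future noise -/

section Noise

variable {X S S' : Type*} [MeasurableSpace X] [MeasurableSpace S] [MeasurableSpace S']

/-- Follow the first sequence up to time `T`, then the second one. -/
def splice (T : ℕ) (p : (ℕ → X) × (ℕ → X)) : ℕ → X :=
  fun j => if j < T then p.1 j else p.2 (j - T)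

lemma measurable_splice (T : ℕ) : Measurable (splice T : (ℕ → X) × (ℕ → X) → ℕ → X) := by
  refine measurable_pi_lambda _ fun j => ?_
  unfold splice
  split_ifs <;> fun_prop

/-- A box splits at `T` into a box for each factor, so its measure is the same product of
one-coordinate measures; such boxes determine the law. -/
lemma map_splice (μ : Measure X) [IsProbabilityMeasure μ] (T : ℕ) :
    ((Measure.infinitePi fun _ : ℕ => μ).prod (Measure.infinitePi fun _ : ℕ => μ)).map (splice T) =
      Measure.infinitePi fun _ : ℕ => μ := by
  refine Measure.eq_infinitePi _ fun s t ht => ?_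
  rw [Measure.map_apply (measurable_splice T) (.pi s.countable_toSet fun i _ => ht i)]
  have hset : splice T ⁻¹' (Set.pi s t) =
      (Set.pi (s.filter (· < T)) t) ×ˢ
        (Set.pi ((s.filter (T ≤ ·)).image (· - T)) fun i => t (i + T)) := by
    ext p
    simp only [Set.mem_preimage, Set.mem_pi, Set.mem_prod, splice, Finset.mem_coe,
      Finset.mem_filter, Finset.mem_image]
    constructor
    · refine fun h => ⟨fun i hi => ?_, ?_⟩
      · simpa [hi.2] using h i hi.1
      · rintro _ ⟨i, ⟨hi, hT⟩, rfl⟩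
        have := h i hi
        rwa [if_neg (by omega), ← Nat.sub_add_cancel hT, Nat.add_sub_cancel] at this
    · rintro ⟨h1, h2⟩ i hi
      split_ifs with hT
      · exact h1 i ⟨hi, hT⟩
      · have := h2 (i - T) ⟨i, ⟨hi, by omega⟩, rfl⟩
        rwa [Nat.sub_add_cancel (by omega)] at this
  rw [hset, Measure.prod_prod, Measure.infinitePi_pi _ (fun i _ => ht i),
    Measure.infinitePi_pi _ (fun i _ => ht _), Finset.prod_image (by
      intro i hi j hj hij
      simp only [Finset.coe_filter, Set.mem_ofPred_eq] at hi hj hij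
      omega), ← Finset.prod_filter_mul_prod_filter_not s (· < T)]
  congr 1
  refine Finset.prod_congr (by ext; simp) fun i hi => ?_
  rw [Nat.sub_add_cancel (by simpa using (Finset.mem_filter.mp hi).2)]

/-- The future noise is independent of any statistic of the past noise. -/
lemma map_prodMk_of_causal (μ : Measure X) [IsProbabilityMeasure μ] (T : ℕ) {F : (ℕ → X) → S}
    (hFm : Measurable F) (hF : ∀ x y : ℕ → X, (∀ j < T, x j = y j) → F x = F y)
    {G : S → (ℕ → X) → S'} (hG : Measurable fun p : S × (ℕ → X) => G p.1 p.2)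
    (κ : Kernel S S') [IsSFiniteKernel κ]
    (hκ : ∀ s, κ s = (Measure.infinitePi fun _ : ℕ => μ).map (G s)) :
    (Measure.infinitePi fun _ : ℕ => μ).map (fun x => (F x, G (F x) fun j => x (j + T))) =
      (Measure.infinitePi fun _ : ℕ => μ).map F ⊗ₘ κ := by
  set ν := Measure.infinitePi fun _ : ℕ => μ
  have hshift : Measurable fun (x : ℕ → X) j => x (j + T) :=
    measurable_pi_lambda _ fun j => measurable_pi_apply _
  have hpair : Measurable fun x : ℕ → X => (F x, G (F x) fun j => x (j + T)) :=
    hFm.prodMk (hG.comp (hFm.prodMk hshift))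
  have hpair' : Measurable fun p : (ℕ → X) × (ℕ → X) => (F p.1, G (F p.1) p.2) :=
    (hFm.comp measurable_fst).prodMk (hG.comp ((hFm.comp measurable_fst).prodMk measurable_snd))
  -- Realize the noise as a splice of two independent sequences: `F` sees only the first one, and
  -- the shifted noise is exactly the second.
  have h1 : ν.map (fun x => (F x, G (F x) fun j => x (j + T))) =
      (ν.prod ν).map fun p => (F p.1, G (F p.1) p.2) := by
    have hs : (ν.prod ν).map (splice T) = ν := map_splice μ T
    conv_lhs => rw [← hs]
    rw [Measure.map_map hpair (measurable_splice T)]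
    congr 1
    funext p
    have hp : F (splice T p) = F p.1 := hF _ _ fun j hj => by simp [splice, hj]
    simp only [Function.comp, hp]
    congr 3
    funext j
    simp [splice]
  rw [h1]
  ext A hA
  rw [Measure.map_apply hpair' hA, Measure.prod_apply (hpair' hA), Measure.compProd_apply hA,
    lintegral_map (Kernel.measurable_kernel_prodMk_left hA) hFm]
  refine lintegral_congr fun x => ?_
  have hGx : Measurable (G (F x)) := hG.comp measurable_prodMk_left
  rw [hκ, Measure.map_apply hGx (measurable_prodMk_left hA)]
  rfl

end Noise

/-! ### Weak convergence from finite-dimensional marginals -/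

section ProjectiveLimits

variable {X ι : Type*} [Countable ι] [MetricSpace X] [CompleteSpace X] [SecondCountableTopology X]
  [MeasurableSpace X] [BorelSpace X]

/-- Laws on a countable product of Polish spaces whose coordinate marginals converge are tight. -/
lemma isTightMeasureSet_of_tendsto_marginals (Ps : ℕ → ProbabilityMeasure (ι → X))
    (Q : ι → ProbabilityMeasure X)
    (hQ : ∀ i, Tendsto (fun N => (Ps N).map (measurable_pi_apply i).aemeasurable) atTop
      (𝓝 (Q i))) :
    IsTightMeasureSet {((P : ProbabilityMeasure (ι → X)) : Measure (ι → X)) | P ∈ Set.range Ps} := by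
  rw [isTightMeasureSet_iff_exists_isCompact_measure_compl_le]
  intro ε hε
  obtain ⟨δ, hδ, hδε⟩ := ENNReal.exists_pos_sum_of_countable' hε.ne' ι
  have hK : ∀ i, ∃ K : Set X, IsCompact K ∧
      ∀ N, (Ps N : Measure (ι → X)) ((fun u => u i) ⁻¹' Kᶜ) ≤ δ i := by
    intro i
    -- A convergent sequence with its limit is compact, hence tight. Choosing compact sets `K i`
    -- with errors `δ i` of total below `ε` makes their product work for the whole family.
    have hc := (hQ i).isCompact_insert_range
    have ht := isTightMeasureSet_of_isCompact_closure (S := insert (Q i) (Set.range fun N =>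
      (Ps N).map (measurable_pi_apply i).aemeasurable)) (by rwa [hc.isClosed.closure_eq])
    rw [isTightMeasureSet_iff_exists_isCompact_measure_compl_le] at ht
    obtain ⟨K, hK, hle⟩ := ht (δ i) (hδ i)
    refine ⟨K, hK, fun N => ?_⟩
    have := hle _ ⟨_, Set.mem_insert_of_mem _ ⟨N, rfl⟩, rfl⟩
    rwa [ProbabilityMeasure.toMeasure_map, Measure.map_apply (measurable_pi_apply i)
      hK.isClosed.measurableSet.compl] at this
  choose K hK hle using hK
  refine ⟨Set.univ.pi K, isCompact_univ_pi hK, ?_⟩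
  rintro _ ⟨_, ⟨N, rfl⟩, rfl⟩
  calc (Ps N : Measure (ι → X)) (Set.univ.pi K)ᶜ
      ≤ (Ps N : Measure (ι → X)) (⋃ i, (fun u => u i) ⁻¹' (K i)ᶜ) := by
        refine measure_mono fun u hu => ?_
        simpa [Set.mem_pi] using hu
    _ ≤ ∑' i, (Ps N : Measure (ι → X)) ((fun u => u i) ⁻¹' (K i)ᶜ) := measure_iUnion_le _
    _ ≤ ∑' i, δ i := ENNReal.tsum_le_tsum fun i => hle i N
    _ ≤ ε := hδε.le

/-- Laws on a countable product of Polish spaces converge weakly if all finite-dimensional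
marginals do. -/
lemma exists_tendsto_of_tendsto_restrict (Ps : ℕ → ProbabilityMeasure (ι → X))
    (hQ : ∀ I : Finset ι, ∃ Q : ProbabilityMeasure (I → X),
      Tendsto (fun N => (Ps N).map (Finset.measurable_restrict I).aemeasurable) atTop (𝓝 Q)) :
    ∃ P : ProbabilityMeasure (ι → X), Tendsto Ps atTop (𝓝 P) := by
  choose Q hQ using hQ
  have hcont : ∀ I : Finset ι, Continuous (I.restrict : (ι → X) → I → X) := fun I =>
    continuous_pi fun i => continuous_apply _
  have htight := isTightMeasureSet_of_tendsto_marginals Ps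
    (fun i => (Q {i}).map (measurable_pi_apply ⟨i, Finset.mem_singleton_self i⟩).aemeasurable)
    fun i => by
      have := ProbabilityMeasure.tendsto_map_of_tendsto_of_continuous _ _ (hQ {i})
        (continuous_apply (⟨i, Finset.mem_singleton_self i⟩ : ({i} : Finset ι)))
      refine this.congr fun N => ?_
      apply Subtype.ext
      simp only [ProbabilityMeasure.val_eq_to_measure, ProbabilityMeasure.toMeasure_map]
      exact Measure.map_map (measurable_pi_apply (⟨i, Finset.mem_singleton_self i⟩ :
        ({i} : Finset ι))) (Finset.measurable_restrict _)
  have hcomp := isCompact_closure_of_isTightMeasureSet htight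
  have hmem : ∀ N, Ps N ∈ closure (Set.range Ps) := fun N => subset_closure ⟨N, rfl⟩
  -- Every cluster point has the marginals `Q I`, which determine it. By Prokhorov the sequence is
  -- relatively compact, so a unique cluster point means convergence.
  have hcl : ∀ P, MapClusterPt P atTop Ps → ∀ I : Finset ι,
      P.map (Finset.measurable_restrict I).aemeasurable = Q I := by
    intro P hP I
    have := hP.continuousAt_comp (f := fun R : ProbabilityMeasure (ι → X) =>
      R.map (hcont I).aemeasurable) (ProbabilityMeasure.continuous_map (hcont I)).continuousAt
    exact eq_of_nhds_neBot (Filter.NeBot.mono this (inf_le_inf_left _ (hQ I)))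
  have huniq : ∀ P P', MapClusterPt P atTop Ps → MapClusterPt P' atTop Ps → P = P' := by
    intro P P' hP hP'
    apply Subtype.ext
    refine IsProjectiveLimit.unique (P := fun I => (Q I : Measure (I → X))) (fun I => ?_)
      fun I => ?_
    · exact congrArg ProbabilityMeasure.toMeasure (hcl P hP I)
    · exact congrArg ProbabilityMeasure.toMeasure (hcl P' hP' I)
  obtain ⟨P, -, hP⟩ := hcomp.exists_mapClusterPt (f := atTop) (u := Ps)
    (tendsto_principal.mpr (Eventually.of_forall hmem))
  exact ⟨P, hcomp.tendsto_nhds_of_unique_mapClusterPt (Eventually.of_forall hmem)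
    fun P' _ hP' => huniq P' P hP' hP⟩

end ProjectiveLimits

/-! ### From uniformly continuous to all bounded continuous test functions -/

section UniformTestFunctions

variable {X : Type*} [MetricSpace X] [SecondCountableTopology X] [MeasurableSpace X]
  [BorelSpace X]

/-- Bounded uniformly continuous functions determine continuous convergence of kernels. -/
lemma KernelTendsto.kernelContTendsto {Ψs : ℕ → Kernel (ℕ → X) (ℕ → X)}
    {Ψ : Kernel (ℕ → X) (ℕ → X)} [∀ N, IsMarkovKernel (Ψs N)] [IsMarkovKernel Ψ]
    (h : KernelTendsto Ψs Ψ) : KernelContTendsto Ψs Ψ := by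
  intro xs x hx
  -- A pseudometric inducing the product uniformity: its Lipschitz functions are uniformly
  -- continuous and suffice to test weak convergence.
  let := UniformSpace.pseudoMetricSpace (ℕ → X)
  let Ps : ℕ → ProbabilityMeasure (ℕ → X) := fun N => ⟨Ψs N (xs N), inferInstance⟩
  let P : ProbabilityMeasure (ℕ → X) := ⟨Ψ x, inferInstance⟩
  refine (weakTendsto_iff (μs := Ps) (μ := P)).mpr ?_
  refine tendsto_iff_forall_lipschitz_integral_tendsto.mpr ?_
  rintro φ ⟨C, hC⟩ ⟨L, hL⟩
  refine h xs x hx φ hL.uniformContinuous ⟨|φ x| + C, fun u => ?_⟩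
  have h1 := hC u x
  rw [Real.dist_eq] at h1
  have h2 := abs_sub_abs_le_abs_sub (φ u) (φ x)
  linarith

end UniformTestFunctions

/-! ### The unit-time step with a variable boundary value -/

section Kernels

variable {X : Type*} [TopologicalSpace X]

lemma continuous_boundaryMap_pair [Zero X] (g : C(X × X, X)) :
    Continuous fun p : X × (ℕ → X) => boundaryMap g p.1 p.2 :=
  continuous_pi fun k => match k with
    | 0 => g.continuous.comp (by fun_prop)
    | _ + 1 => continuous_const

variable [SecondCountableTopology X] [MeasurableSpace X] [BorelSpace X] [AddGroup X]
  [ContinuousAdd X]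

/-- The unit-time kernel as a joint kernel in the boundary value and the state. -/
def stepKernel (g : C(X × X, X)) (Ψ : Kernel (ℕ → X) (ℕ → X)) : Kernel (X × (ℕ → X)) (ℕ → X) :=
  (((Ψ ∘ₖ Ψ).comap Prod.snd measurable_snd) ×ₖ Kernel.deterministic
    (fun p : X × (ℕ → X) => boundaryMap g p.1 p.2)
    (continuous_boundaryMap_pair g).measurable).map fun p => p.1 + p.2

instance (g : C(X × X, X)) (Ψ : Kernel (ℕ → X) (ℕ → X)) [IsMarkovKernel Ψ] :
    IsMarkovKernel (stepKernel g Ψ) :=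
  Kernel.IsMarkovKernel.map _ measurable_add_seq

lemma measurable_add_const_seq (c : ℕ → X) : Measurable fun u : ℕ → X => u + c :=
  (continuous_id.add continuous_const).measurable

lemma stepKernel_apply (g : C(X × X, X)) (Ψ : Kernel (ℕ → X) (ℕ → X)) [IsMarkovKernel Ψ]
    (p : X × (ℕ → X)) :
    stepKernel g Ψ p = ((Ψ ∘ₖ Ψ) p.2).map fun u => u + boundaryMap g p.1 p.2 := by
  rw [stepKernel, Kernel.map_apply _ measurable_add_seq, Kernel.prod_apply, Kernel.comap_apply,
    Kernel.deterministic_apply, Measure.prod_dirac,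
    Measure.map_map measurable_add_seq measurable_prodMk_right]
  rfl

lemma stepKernel_eq_unitTimeKernel (g : C(X × X, X)) (Ψ : Kernel (ℕ → X) (ℕ → X))
    [IsMarkovKernel Ψ] (b : X) (a : ℕ → X) :
    stepKernel g Ψ (b, a) = unitTimeKernel g Ψ b a := by
  rw [stepKernel_apply]
  ext A hA
  rw [unitTimeKernel, boundaryKernel, convKernel_deterministic_apply _ _ _ _ hA,
    Measure.map_apply (measurable_add_const_seq _) hA]
  rfl

/-- The law of two half-time steps converges by composition, and the translation added to it depends
continuously on boundary value and state. Both may move, because beyond scale `s` the boundary value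
is the random `u_s`. -/
lemma KernelContTendsto.stepKernel [TopologicalSpace.PseudoMetrizableSpace X] (g : C(X × X, X)) {Ψs : ℕ → Kernel (ℕ → X) (ℕ → X)}
    {Ψ : Kernel (ℕ → X) (ℕ → X)} [∀ N, IsMarkovKernel (Ψs N)] [IsMarkovKernel Ψ]
    (h : KernelContTendsto Ψs Ψ) :
    KernelContTendsto (fun N => SpontStoch.stepKernel g (Ψs N)) (SpontStoch.stepKernel g Ψ) := by
  intro ps p hp
  simp only [stepKernel_apply]
  refine (h.comp h _ _ ((continuous_snd.tendsto p).comp hp)).map (fun us u hu => ?_)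
    (fun N => measurable_add_const_seq _) (measurable_add_const_seq _)
  exact hu.add (((continuous_boundaryMap_pair g).tendsto p).comp hp)

end Kernels

/-! ### Histories of the scales beyond a given scale -/

section Histories

variable {X : Type*} [TopologicalSpace X] [AddGroup X]

/-- The entries kept lie at scales up to `s + M`, and by time `j τ_s` these have read noise only at
positions `2 * i` with `i < j * 2 ^ M`. The first discarded entry is the noise at position `j * 2 ^
(M + 1)` itself. -/
lemma truncate_regState_congr (f g : C(X × X, X)) (s M : ℕ) (a b : ℕ → X) (j : ℕ) {x y : ℕ → X}
    (h : ∀ i < j * 2 ^ (M + 1), x i = y i) :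
    truncate M (regState f g (s + M) a b s j x) = truncate M (regState f g (s + M) a b s j y) := by
  funext k
  unfold truncate
  split_ifs with hk
  · refine regField_congr f g _ _ _ (by omega) (fun _ _ => rfl) (fun i hi => h _ ?_) fun _ _ => rfl
    rw [mul_assoc, ← pow_add, show k + 1 + (s + M - (s + k + 1)) = M by omega] at hi
    rw [pow_succ, ← mul_assoc]
    omega
  · rfl

/-- Truncated states beyond scale `s` at the times `0, τ_s, …, J τ_s`. -/
def regHistory (f g : C(X × X, X)) (a b : ℕ → X) (s M J : ℕ) (x : ℕ → X) : ℕ → ℕ → X :=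
  fun j => if j ≤ J then truncate M (regState f g (s + M) a b s j x) else 0

/-- The field at scale `n ≤ s`, as a function of the history of the scales beyond `s`. -/
def fieldOfHistory (f g : C(X × X, X)) (a b : ℕ → X) (s n m : ℕ) (h : ℕ → ℕ → X) : X :=
  regField f g s a b (fun i => h (i / 2) 0) n m

lemma continuous_fieldOfHistory [ContinuousAdd X] (f g : C(X × X, X)) (a b : ℕ → X) (s n m : ℕ) :
    Continuous (fieldOfHistory f g a b s n m) :=
  (continuous_regField_noise f g s a b n m).comp (by fun_prop)

/-- Scale `s + 1` is read only at times `j τ_s` strictly before the current one, so a history up to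
`J` reaches one step further, to `J + 1`. The condition `1 ≤ M` keeps scale `s + 1` within the
truncation. -/
lemma fieldOfHistory_regHistory (f g : C(X × X, X)) (a b : ℕ → X) (s M J : ℕ) (hM : 1 ≤ M)
    (x : ℕ → X) (n m : ℕ) (hn : n ≤ s) (hm : m * 2 ^ (s - n) ≤ J + 1) :
    fieldOfHistory f g a b s n m (regHistory f g a b s M J x) =
      regField f g (s + M) a b x n m := by
  refine (regField_eq_of_path f g (Nat.le_add_right s M) a b x _ n m hn fun j hj => ?_).symm
  rw [regHistory, if_pos (by omega), truncate_of_lt (by omega)]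

end Histories

/-! ### Half-time and history kernels -/

section RegularizedLaws

variable {X : Type*} [TopologicalSpace X] [SecondCountableTopology X] [MeasurableSpace X]
  [BorelSpace X] [AddGroup X]

lemma measurable_truncate (M : ℕ) : Measurable (truncate M : (ℕ → X) → ℕ → X) :=
  (continuous_truncate M).measurable

variable [ContinuousAdd X]

lemma measurable_regHalf (f g : C(X × X, X)) (M : ℕ) :
    Measurable fun p : (ℕ → X) × (ℕ → X) => regHalf f g M p.1 p.2 :=
  measurable_pi_lambda _ fun k => measurable_regField f g M _ (k + 1) (2 ^ k)

lemma measurable_regState (f g : C(X × X, X)) (N : ℕ) (a b : ℕ → X) (s j : ℕ) :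
    Measurable (regState f g N a b s j) :=
  measurable_pi_lambda _ fun _ =>
    (measurable_regField f g N b _ _).comp measurable_prodMk_left

variable (μ : Measure X) [IsProbabilityMeasure μ]

lemma halfTimeKernel_apply (f g : C(X × X, X)) (M : ℕ) (a : ℕ → X) :
    halfTimeKernel f g μ M a = (Measure.infinitePi fun _ : ℕ => μ).map (regHalf f g M a) := rfl

instance (f g : C(X × X, X)) (M : ℕ) : IsMarkovKernel (halfTimeKernel f g μ M) where
  isProbabilityMeasure a := by
    rw [halfTimeKernel_apply]
    exact Measure.isProbabilityMeasure_map
      ((measurable_regHalf f g M).comp measurable_prodMk_left).aemeasurable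

/-- The law of two consecutive half-time steps driven by the same noise sequence. -/
lemma halfTimeKernel_comp_apply (f g : C(X × X, X)) (M : ℕ) (a : ℕ → X) :
    (halfTimeKernel f g μ M ∘ₖ halfTimeKernel f g μ M) a =
      (Measure.infinitePi fun _ : ℕ => μ).map fun x =>
        regHalf f g M (regHalf f g M a x) fun i => x (i + 2 ^ M) := by
  have hH : Measurable (regHalf f g M a) := (measurable_regHalf f g M).comp measurable_prodMk_left
  -- The state at `τ_1` displays `x (2 ^ M)` at scale `M + 1`, which the second step uses too.
  -- Truncation removes it, harmlessly by `htr`: a step reads only the first `M` initial entries.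
  have hF : Measurable fun x => truncate M (regHalf f g M a x) := (measurable_truncate M).comp hH
  have htr : ∀ c y : ℕ → X, regHalf f g M (truncate M c) y = regHalf f g M c y := fun c y =>
    regHalf_congr f g M y fun k hk => truncate_of_lt hk c
  have h := map_prodMk_of_causal μ (2 ^ M) hF (fun x y hxy => by
    funext k
    unfold truncate
    split_ifs with hk
    · refine regField_congr f g _ _ _ (by omega) (fun _ _ => rfl) (fun i hi => hxy _ ?_)
        fun _ _ => rfl
      rw [← pow_add, show k + (M - (k + 1)) = M - 1 by omega] at hi
      rw [show M = M - 1 + 1 by omega, pow_succ]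
      omega
    · rfl) (measurable_regHalf f g M) (halfTimeKernel f g μ M) (halfTimeKernel_apply μ f g M)
  have hshift : Measurable fun (x : ℕ → X) (j : ℕ) => x (j + 2 ^ M) :=
    measurable_pi_lambda _ fun j => measurable_pi_apply _
  simp only [htr] at h
  have h2 := congrArg Measure.snd h
  rw [Measure.snd_compProd, Measure.snd_map_prodMk hF] at h2
  rw [h2, Kernel.comp_apply, halfTimeKernel_apply μ f g M a]
  ext A hA
  rw [Measure.bind_apply hA (Kernel.aemeasurable _), Measure.bind_apply hA (Kernel.aemeasurable _),
    lintegral_map (Kernel.measurable_coe _ hA) hH, lintegral_map (Kernel.measurable_coe _ hA) hF]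
  simp only [halfTimeKernel_apply, funext (htr _)]

lemma measurable_regHistory (f g : C(X × X, X)) (a b : ℕ → X) (s M J : ℕ) :
    Measurable (regHistory f g a b s M J) := by
  refine measurable_pi_lambda _ fun j => ?_
  unfold regHistory
  split_ifs
  · exact (measurable_truncate M).comp (measurable_regState f g _ a b s j)
  · exact measurable_const

lemma measurable_fieldOfHistory_prodMk (f g : C(X × X, X)) (a b : ℕ → X) (s J : ℕ) :
    Measurable fun h : ℕ → ℕ → X => (fieldOfHistory f g a b s s J h, h J) :=
  (continuous_fieldOfHistory f g a b s s J).measurable.prodMk (measurable_pi_apply J)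

/-- The transition kernel from the history up to time `J τ_s` to the state at `(J + 1) τ_s`. -/
def historyKernel (f g : C(X × X, X)) (a b : ℕ → X) (Ψ : Kernel (ℕ → X) (ℕ → X)) (s J : ℕ) :
    Kernel (ℕ → ℕ → X) (ℕ → X) :=
  (stepKernel g Ψ).comap (fun h : ℕ → ℕ → X => (fieldOfHistory f g a b s s J h, h J))
    (measurable_fieldOfHistory_prodMk f g a b s J)

end RegularizedLaws

/-! ### Markov identities before the limit -/

section MarkovIdentities

variable {X : Type*} [TopologicalSpace X] [SecondCountableTopology X] [MeasurableSpace X]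
  [BorelSpace X] [AddGroup X] [ContinuousAdd X] (μ : Measure X) [IsProbabilityMeasure μ]

instance (f g : C(X × X, X)) (a b : ℕ → X) (Ψ : Kernel (ℕ → X) (ℕ → X)) [IsMarkovKernel Ψ]
    (s J : ℕ) : IsMarkovKernel (historyKernel f g a b Ψ s J) := by
  unfold historyKernel
  infer_instance

/-- The Markov property of the regularized solution on the scales beyond `s`. -/
lemma map_regHistory_prodMk_regState (f g : C(X × X, X)) (a b : ℕ → X) (s M J : ℕ) (hM : 1 ≤ M) :
    (Measure.infinitePi fun _ : ℕ => μ).map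
        (fun x => (regHistory f g a b s M J x, regState f g (s + M) a b s (J + 1) x)) =
      (Measure.infinitePi fun _ : ℕ => μ).map (regHistory f g a b s M J) ⊗ₘ
        historyKernel f g a b (halfTimeKernel f g μ M) s J := by
  have hHm := measurable_regHalf f g M
  have hshift : Measurable fun (x : ℕ → X) (j : ℕ) => x (j + 2 ^ M) :=
    measurable_pi_lambda _ fun j => measurable_pi_apply _
  have hfield := measurable_fieldOfHistory_prodMk f g a b s J
  have hHH : Measurable fun p : (ℕ → X) × (ℕ → X) =>
      regHalf f g M (regHalf f g M p.1 p.2) fun i => p.2 (i + 2 ^ M) :=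
    hHm.comp (hHm.prodMk (hshift.comp measurable_snd))
  -- One step of length `τ_s` as a function of the history and the fresh noise; the boundary value
  -- at scale `s` is recovered from the history.
  let G : (ℕ → ℕ → X) → (ℕ → X) → ℕ → X := fun h y =>
    regHalf f g M (regHalf f g M (h J) y) (fun i => y (i + 2 ^ M)) +
      boundaryMap g (fieldOfHistory f g a b s s J h) (h J)
  have hG : Measurable fun p : (ℕ → ℕ → X) × (ℕ → X) => G p.1 p.2 := by
    refine measurable_add_seq.comp (Measurable.prodMk ?_ ?_)
    · exact hHH.comp (f := fun p : (ℕ → ℕ → X) × (ℕ → X) => (p.1 J, p.2))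
        (((measurable_pi_apply J).comp measurable_fst).prodMk measurable_snd)
    · exact (continuous_boundaryMap_pair g).measurable.comp (hfield.comp measurable_fst)
  have h := map_prodMk_of_causal μ (J * 2 ^ (M + 1)) (measurable_regHistory f g a b s M J)
    (fun x y hxy => by
      funext j
      unfold regHistory
      split_ifs with hj
      · rw [truncate_regState_congr f g s M a b j fun i hi =>
          hxy i (hi.trans_le (Nat.mul_le_mul_right _ hj))]
      · rfl) hG (historyKernel f g a b (halfTimeKernel f g μ M) s J) (fun h => by
      have hm : Measurable fun y : ℕ → X =>
          regHalf f g M (regHalf f g M (h J) y) (fun i => y (i + 2 ^ M)) :=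
        hHH.comp measurable_prodMk_left
      rw [historyKernel, Kernel.comap_apply, stepKernel_apply, halfTimeKernel_comp_apply,
        Measure.map_map (measurable_add_const_seq _) hm]
      rfl)
  rw [← h]
  congr 1
  funext x
  have hJ : regHistory f g a b s M J x J = truncate M (regState f g (s + M) a b s J x) :=
    if_pos le_rfl
  have hlow := fieldOfHistory_regHistory f g a b s M J hM x s J le_rfl (by simp)
  have htr : ∀ y, regHalf f g M (truncate M (regState f g (s + M) a b s J x)) y =
      regHalf f g M (regState f g (s + M) a b s J x) y := fun y =>
    regHalf_congr f g M y fun k hk => truncate_of_lt hk _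
  rw [regState_succ f g s M hM]
  simp only [G, hlow, hJ, htr]
  congr 2
  funext k
  rcases k with _ | k
  · rw [boundaryMap, boundaryMap, truncate_of_lt hM]
  · rfl

/-- The half-time transition of the regularized solution on the scales beyond `s`. -/
lemma map_regField_halfTime (f g : C(X × X, X)) (a b : ℕ → X) (s M j : ℕ) :
    (Measure.infinitePi fun _ : ℕ => μ).map
        (fun x k => regField f g (s + M) a b x (s + k + 1) ((2 * j + 1) * 2 ^ k)) =
      halfTimeKernel f g μ M ∘ₘ (Measure.infinitePi fun _ : ℕ => μ).map
        (fun x => truncate M (regState f g (s + M) a b s j x)) := by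
  have hF : Measurable fun x => truncate M (regState f g (s + M) a b s j x) :=
    (measurable_truncate M).comp (measurable_regState f g _ a b s j)
  have h := map_prodMk_of_causal μ (j * 2 ^ (M + 1)) hF
    (fun x y hxy => truncate_regState_congr f g s M a b j hxy) (measurable_regHalf f g M)
    (halfTimeKernel f g μ M) (halfTimeKernel_apply μ f g M)
  have h2 := congrArg Measure.snd h
  rw [Measure.snd_compProd, Measure.snd_map_prodMk hF] at h2
  rw [← h2]
  congr 1
  funext x k
  rw [regField_halfTime_shift]
  exact congrFun (regHalf_congr f g M _ fun k hk => (truncate_of_lt hk _).symm) k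

lemma solutionLaw_coe (f g : C(X × X, X)) (N : ℕ) (a b : ℕ → X) :
    (solutionLaw f g μ N a b : Measure (Lattice → X)) =
      (Measure.infinitePi fun _ : ℕ => μ).map (regSolution f g N a b) := rfl

end MarkovIdentities

/-! ### Existence of the limit law -/

section Limits

variable {X : Type*} [MetricSpace X] [SecondCountableTopology X] [MeasurableSpace X]
  [BorelSpace X] [AddGroup X] [ContinuousAdd X]

lemma KernelContTendsto.historyKernel (f g : C(X × X, X)) (a b : ℕ → X)
    {Ψs : ℕ → Kernel (ℕ → X) (ℕ → X)}
    {Ψ : Kernel (ℕ → X) (ℕ → X)} [∀ N, IsMarkovKernel (Ψs N)] [IsMarkovKernel Ψ]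
    (h : KernelContTendsto Ψs Ψ) (s J : ℕ) :
    KernelContTendsto (fun N => SpontStoch.historyKernel f g a b (Ψs N) s J)
      (SpontStoch.historyKernel f g a b Ψ s J) :=
  (h.stepKernel g).comap ((continuous_fieldOfHistory f g a b s s J).prodMk (continuous_apply J)) _

variable {f g : C(X × X, X)} {μ : Measure X} [IsProbabilityMeasure μ]
  {Ψ : Kernel (ℕ → X) (ℕ → X)} [IsMarkovKernel Ψ]

/-- The laws of the histories of the scales beyond `s` converge. -/
lemma exists_weakTendsto_regHistory (hΨ : KernelContTendsto (halfTimeKernel f g μ) Ψ)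
    (a b : ℕ → X) (s J : ℕ) :
    ∃ Q : Measure (ℕ → ℕ → X), IsProbabilityMeasure Q ∧
      WeakTendsto (fun M => (Measure.infinitePi fun _ : ℕ => μ).map (regHistory f g a b s M J))
        Q := by
  induction J with
  | zero =>
    -- At time 0 the truncated state is the truncated initial condition, so the law is a point mass.
    let w : ℕ → ℕ → ℕ → X := fun M j => if j ≤ 0 then truncate M (fun k => a (s + k)) else 0
    let w' : ℕ → ℕ → X := fun j => if j ≤ 0 then fun k => a (s + k) else 0
    have hw : ∀ M x, regHistory f g a b s M 0 x = w M := by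
      intro M x
      funext j k
      simp only [regHistory, w]
      split_ifs with hj
      · obtain rfl : j = 0 := by omega
        unfold truncate
        split_ifs with hk
        · rw [regState, zero_mul, regField_init _ _ _ _ _ _ (by omega) (by omega)]
          rfl
        · rfl
      · rfl
    have hlim : Tendsto w atTop (𝓝 w') := by
      rw [tendsto_pi_nhds]
      intro j
      simp only [w, w']
      split_ifs
      · exact contTendsto_truncate (fun _ => fun k => a (s + k)) _ tendsto_const_nhds
      · exact tendsto_const_nhds
    refine ⟨Measure.dirac w', inferInstance, ?_⟩
    simp only [funext (hw _), Measure.map_const, measure_univ, one_smul]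
    exact weakTendsto_dirac hlim
  | succ J ih =>
    obtain ⟨Q, hQ, hlim⟩ := ih
    have hprob : ∀ M, IsProbabilityMeasure
        ((Measure.infinitePi fun _ : ℕ => μ).map (regHistory f g a b s M J)) := fun M =>
      Measure.isProbabilityMeasure_map (measurable_regHistory f g a b s M J).aemeasurable
    -- Append the new state to the history. The joint law before appending converges by the Markov
    -- identity, and the truncation inside `ext` disappears in the limit.
    let ext : ℕ → (ℕ → ℕ → X) × (ℕ → X) → ℕ → ℕ → X := fun M p =>
      Function.update p.1 (J + 1) (truncate M p.2)
    let ext' : (ℕ → ℕ → X) × (ℕ → X) → ℕ → ℕ → X := fun p => Function.update p.1 (J + 1) p.2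
    have hext' : Continuous ext' := continuous_fst.update (J + 1) continuous_snd
    have hext : ∀ M, Continuous (ext M) := fun M =>
      continuous_fst.update (J + 1) ((continuous_truncate M).comp continuous_snd)
    have hcont : ContTendsto ext ext' := fun ps p hp =>
      ((continuous_fst.tendsto p).comp hp).update (J + 1)
        (contTendsto_truncate _ _ ((continuous_snd.tendsto p).comp hp))
    refine ⟨(Q ⊗ₘ historyKernel f g a b Ψ s J).map ext',
      Measure.isProbabilityMeasure_map hext'.measurable.aemeasurable, ?_⟩
    refine ((hlim.compProd (hΨ.historyKernel f g a b s J)).map hcont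
      (fun M => (hext M).measurable) hext'.measurable).congr' ?_
    filter_upwards [eventually_ge_atTop 1] with M hM
    rw [← map_regHistory_prodMk_regState μ f g a b s M J hM, Measure.map_map (hext M).measurable
      ((measurable_regHistory f g a b s M J).prodMk (measurable_regState f g _ a b s (J + 1)))]
    congr 1
    funext x j
    simp only [Function.comp, ext, Function.update_apply, regHistory]
    split_ifs with h1 h2 h3 h4 h5
    · rw [h1]
    · omega
    · rfl
    · omega
    · omega
    · rfl

/-- The laws of the regularized solutions converge weakly. -/
lemma exists_tendsto_solutionLaw [CompleteSpace X]
    (hΨ : KernelContTendsto (halfTimeKernel f g μ) Ψ)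
    (a b : ℕ → X) :
    ∃ P : ProbabilityMeasure (Lattice → X),
      Tendsto (fun N => solutionLaw f g μ N a b) atTop (𝓝 P) := by
  refine exists_tendsto_of_tendsto_restrict _ fun I => ?_
  -- The finest scale occurring in `I`, and the latest time in units of `τ_s`: a single history
  -- beyond `s` determines all values on `I`.
  let s := I.sup fun p => p.1.1
  let J := I.sup fun p => p.1.2 * 2 ^ (s - p.1.1)
  obtain ⟨Q, hQ, hlim⟩ := exists_weakTendsto_regHistory hΨ a b s J
  let Θ : (ℕ → ℕ → X) → I → X := fun h p => fieldOfHistory f g a b s p.1.1.1 p.1.1.2 h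
  have hΘ : Continuous Θ := continuous_pi fun p => continuous_fieldOfHistory f g a b s _ _
  have hprob : ∀ M, IsProbabilityMeasure
      ((Measure.infinitePi fun _ : ℕ => μ).map (regHistory f g a b s M J)) := fun M =>
    Measure.isProbabilityMeasure_map (measurable_regHistory f g a b s M J).aemeasurable
  have hQΘ : IsProbabilityMeasure (Q.map Θ) :=
    Measure.isProbabilityMeasure_map hΘ.measurable.aemeasurable
  let R : ProbabilityMeasure (I → X) := ⟨Q.map Θ, hQΘ⟩
  refine ⟨R, ?_⟩
  rw [← tendsto_add_atTop_iff_nat s, ← weakTendsto_iff]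
  refine (hlim.map (ContTendsto.of_continuous hΘ) (fun _ => hΘ.measurable)
    hΘ.measurable).congr' ?_
  filter_upwards [eventually_ge_atTop 1] with M hM
  rw [Measure.map_map hΘ.measurable (measurable_regHistory f g a b s M J)]
  rw [ProbabilityMeasure.toMeasure_map, solutionLaw_coe,
    Measure.map_map (Finset.measurable_restrict I) (measurable_regSolution f g _ a b)]
  congr 1
  funext x p
  have h1 : p.1.1.1 ≤ s := Finset.le_sup (f := fun p : Lattice => p.1.1) p.2
  have h2 : p.1.1.2 * 2 ^ (s - p.1.1.1) ≤ J :=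
    Finset.le_sup (f := fun p : Lattice => p.1.2 * 2 ^ (s - p.1.1)) p.2
  simp only [Function.comp, Θ, Finset.restrict, regSolution]
  rw [fieldOfHistory_regHistory f g a b s M J hM x _ _ h1 (by omega), Nat.add_comm]

end Limits

/-! ### States of lattice fields -/

section LatticeFields

variable {X : Type*}

/-- The restriction `n ≤ N` matters at `m = 0`: beyond scale `N` the regularized solution starts
from noise or zero, while `extendField` inserts `a`. Truncated states never see this discrepancy. -/
lemma extendField_regSolution [TopologicalSpace X] [AddGroup X] (f g : C(X × X, X)) {N : ℕ}
    (a b x : ℕ → X) {n : ℕ} (hn : n ≤ N) (m : ℕ) :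
    extendField a b (regSolution f g N a b x) n m = regField f g N a b x n m := by
  unfold extendField
  split_ifs with h1 hm
  · rfl
  · obtain rfl : m = 0 := by omega
    rw [regField_init _ _ _ _ _ _ h1 hn]
  · obtain rfl : n = 0 := by omega
    rw [regField_zero]

lemma truncate_stateAt_regSolution [TopologicalSpace X] [AddGroup X] (f g : C(X × X, X))
    (a b x : ℕ → X) (s M m : ℕ) :
    truncate M (stateAt a b (s + 1) m (regSolution f g (s + M) a b x)) =
      truncate M fun k => regField f g (s + M) a b x (s + k + 1) (m * 2 ^ k) := by
  funext k
  unfold truncate stateAt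
  split_ifs with hk
  · rw [extendField_regSolution f g a b x (by omega), Nat.add_right_comm]
  · rfl

lemma truncate_stateAt_two_mul_regSolution [TopologicalSpace X] [AddGroup X] (f g : C(X × X, X))
    (a b x : ℕ → X) (s M j : ℕ) :
    truncate M (stateAt a b (s + 1) (2 * j) (regSolution f g (s + M) a b x)) =
      truncate M (regState f g (s + M) a b s j x) := by
  rw [truncate_stateAt_regSolution]
  congr 1
  funext k
  rw [regState, show 2 * j * 2 ^ k = j * 2 ^ (k + 1) by ring]

lemma continuous_extendField [TopologicalSpace X] (a b : ℕ → X) (n m : ℕ) :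
    Continuous fun u : Lattice → X => extendField a b u n m := by
  unfold extendField
  split_ifs
  · exact continuous_apply _
  · exact continuous_const
  · exact continuous_const

lemma continuous_stateAt [TopologicalSpace X] (a b : ℕ → X) (s m : ℕ) :
    Continuous (stateAt a b s m) :=
  continuous_pi fun k => continuous_extendField a b (s + k) (m * 2 ^ k)

lemma continuous_idealRHS_extendField [TopologicalSpace X] [AddGroup X] [ContinuousAdd X]
    (f g : C(X × X, X)) (a b : ℕ → X) (n m : ℕ) :
    Continuous fun u : Lattice → X => idealRHS f g (extendField a b u) n m := by
  have h := continuous_extendField a b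
  unfold idealRHS
  split_ifs
  · exact (f.continuous.comp ((h _ _).prodMk (h _ _))).add
      (g.continuous.comp ((h _ _).prodMk (h _ _)))
  · exact f.continuous.comp ((h _ _).prodMk (h _ _))

lemma stateAt_zero (a b : ℕ → X) (s : ℕ) (u : Lattice → X) :
    stateAt a b (s + 1) 0 u = fun k => a (s + k) := by
  funext k
  rw [stateAt, extendField, dif_pos (by omega), dif_neg (by omega)]
  congr 1
  omega

lemma iterate_shiftUp_apply (d : ℕ) (a : ℕ → X) (k : ℕ) : shiftUp^[d] a k = a (d + k) := by
  induction d generalizing a with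
  | zero => simp
  | succ d ih =>
    rw [Function.iterate_succ_apply, ih, shiftUp]
    congr 1
    omega

lemma stateAt_add (a b : ℕ → X) (s d m : ℕ) (u : Lattice → X) :
    stateAt a b (s + d) (m * 2 ^ d) u = shiftUp^[d] (stateAt a b s m u) := by
  funext k
  rw [iterate_shiftUp_apply, stateAt, stateAt, pow_add, mul_assoc, add_assoc]

/-- The states beyond scale `s` at the times `0, τ_s, …, J τ_s`. -/
def stateHistory [Zero X] (a b : ℕ → X) (s J : ℕ) (u : Lattice → X) : ℕ → ℕ → X :=
  fun j => if j ≤ J then stateAt a b (s + 1) (2 * j) u else 0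

lemma continuous_stateHistory [Zero X] [TopologicalSpace X] (a b : ℕ → X) (s J : ℕ) :
    Continuous (stateHistory a b s J) := by
  refine continuous_pi fun j => ?_
  unfold stateHistory
  split_ifs
  · exact continuous_stateAt a b _ _
  · exact continuous_const

lemma measurable_shiftUp_iterate [TopologicalSpace X] [SecondCountableTopology X]
    [MeasurableSpace X] [BorelSpace X] (d : ℕ) : Measurable (shiftUp^[d] : (ℕ → X) → ℕ → X) :=
  continuous_shiftUp.measurable.iterate d

lemma contTendsto_truncate_comp [Zero X] [TopologicalSpace X] {S : Type*}
    [TopologicalSpace S] {h : S → ℕ → X}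
    (hh : Continuous h) : ContTendsto (fun M x => truncate M (h x)) h :=
  fun _ x hx => contTendsto_truncate _ _ ((hh.tendsto x).comp hx)

end LatticeFields

/-! ### Properties of the limit law -/

section LimitLaw

variable {X : Type*} [MetricSpace X] [SecondCountableTopology X]
  [MeasurableSpace X] [BorelSpace X] [AddGroup X] [ContinuousAdd X]
  {f g : C(X × X, X)} {μ : Measure X} [IsProbabilityMeasure μ]
  {Ψ : Kernel (ℕ → X) (ℕ → X)} [IsMarkovKernel Ψ] {a b : ℕ → X}
  {P : ProbabilityMeasure (Lattice → X)}

/-- Limits of the laws of regularized solutions are supported on weak solutions. -/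
lemma ae_isWeakSolution (hP : Tendsto (fun N => solutionLaw f g μ N a b) atTop (𝓝 P)) :
    ∀ᵐ u ∂(P : Measure (Lattice → X)), IsWeakSolution f g a b u := by
  simp only [IsWeakSolution, ae_all_iff]
  intro n m hn hm
  set C : Set (Lattice → X) :=
    {u | extendField a b u n m = idealRHS f g (extendField a b u) n m} with hCdef
  have hC : IsClosed C :=
    isClosed_eq (continuous_extendField a b n m) (continuous_idealRHS_extendField f g a b n m)
  -- The equation at scale `n` involves scale `n + 1`, hence `N > n`. Full mass of the closed set
  -- `C` then passes to the limit by the portmanteau inequality.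
  have hone : ∀ᶠ N in atTop, (solutionLaw f g μ N a b : Measure (Lattice → X)) C = 1 := by
    filter_upwards [eventually_gt_atTop n] with N hN
    rw [solutionLaw_coe, Measure.map_apply (measurable_regSolution f g N a b) hC.measurableSet]
    convert! measure_univ (μ := Measure.infinitePi fun _ : ℕ => μ)
    refine Set.eq_univ_of_forall fun x => ?_
    simp only [C, Set.mem_preimage, Set.mem_ofPred_eq]
    rw [extendField_regSolution f g a b x hN.le, regField_eq _ _ _ _ _ _ hn hN.le hm]
    simp only [idealRHS, extendField_regSolution f g a b x hN.le,
      extendField_regSolution f g a b x (show n + 1 ≤ N from hN),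
      extendField_regSolution f g a b x (show n - 1 ≤ N by omega)]
  have hle := ProbabilityMeasure.limsup_measure_closed_le_of_tendsto hP hC
  rw [limsup_congr hone, limsup_const] at hle
  have : (P : Measure (Lattice → X)) C = 1 := le_antisymm prob_le_one hle
  exact (prob_compl_eq_zero_iff hC.measurableSet).mpr this

lemma weakTendsto_solutionLaw_add
    (hP : Tendsto (fun N => solutionLaw f g μ N a b) atTop (𝓝 P)) (s : ℕ) :
    WeakTendsto (fun M => (solutionLaw f g μ (s + M) a b : Measure (Lattice → X))) P :=
  (weakTendsto_iff.mpr hP).comp_tendsto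
    (k := fun M => s + M) (tendsto_atTop_mono (fun M => Nat.le_add_left M s) tendsto_id)

lemma weakTendsto_regState (hP : Tendsto (fun N => solutionLaw f g μ N a b) atTop (𝓝 P))
    (s j : ℕ) :
    WeakTendsto (fun M => (Measure.infinitePi fun _ : ℕ => μ).map
        fun x => truncate M (regState f g (s + M) a b s j x))
      ((P : Measure (Lattice → X)).map (stateAt a b (s + 1) (2 * j))) := by
  have hst := continuous_stateAt a b (s + 1) (2 * j)
  have hm : ∀ M, Measurable fun u => truncate M (stateAt a b (s + 1) (2 * j) u) := fun M =>
    (measurable_truncate M).comp hst.measurable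
  refine ((weakTendsto_solutionLaw_add hP s).map (contTendsto_truncate_comp hst) hm
    hst.measurable).congr' (Eventually.of_forall fun M => ?_)
  rw [solutionLaw_coe, Measure.map_map (hm M) (measurable_regSolution f g _ a b)]
  congr 1
  funext x
  exact truncate_stateAt_two_mul_regSolution f g a b x s M j

/-- The half-time transition on the scales beyond `s` under the limit law. -/
lemma map_stateAt_halfTime (hΨ : KernelContTendsto (halfTimeKernel f g μ) Ψ)
    (hP : Tendsto (fun N => solutionLaw f g μ N a b) atTop (𝓝 P)) (s j : ℕ) :
    (P : Measure (Lattice → X)).map (stateAt a b (s + 1) (2 * j + 1)) =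
      Ψ ∘ₘ (P : Measure (Lattice → X)).map (stateAt a b (s + 1) (2 * j)) := by
  have hst := continuous_stateAt a b (s + 1) (2 * j + 1)
  have hm : ∀ M, Measurable fun u => truncate M (stateAt a b (s + 1) (2 * j + 1) u) := fun M =>
    (measurable_truncate M).comp hst.measurable
  have hprob : ∀ M, IsProbabilityMeasure ((Measure.infinitePi fun _ : ℕ => μ).map
      fun x => truncate M (regState f g (s + M) a b s j x)) := fun M =>
    Measure.isProbabilityMeasure_map
      ((measurable_truncate M).comp (measurable_regState f g _ a b s j)).aemeasurable
  have hprob1 : IsProbabilityMeasure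
      ((P : Measure (Lattice → X)).map (stateAt a b (s + 1) (2 * j))) :=
    Measure.isProbabilityMeasure_map (continuous_stateAt a b _ _).measurable.aemeasurable
  have hprob2 : IsProbabilityMeasure
      ((P : Measure (Lattice → X)).map (stateAt a b (s + 1) (2 * j + 1))) :=
    Measure.isProbabilityMeasure_map hst.measurable.aemeasurable
  have h1 := (weakTendsto_solutionLaw_add hP s).map (contTendsto_truncate_comp hst) hm
    hst.measurable
  -- The same truncated laws have a second limit, obtained by sending the half-time identity through
  -- `Ψ`; weak limits are unique.
  have h2 := ((weakTendsto_regState hP s j).bind hΨ).map contTendsto_truncate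
    measurable_truncate measurable_id
  rw [Measure.map_id] at h2
  refine h1.unique (h2.congr' (Eventually.of_forall fun M => ?_))
  have hmf : Measurable fun (x : ℕ → X) k =>
      regField f g (s + M) a b x (s + k + 1) ((2 * j + 1) * 2 ^ k) :=
    measurable_pi_lambda _ fun k =>
      (measurable_regField f g (s + M) b _ _).comp measurable_prodMk_left
  rw [← map_regField_halfTime, solutionLaw_coe, Measure.map_map (measurable_truncate M) hmf,
    Measure.map_map (hm M) (measurable_regSolution f g _ a b)]
  congr 1
  funext x
  exact (truncate_stateAt_regSolution f g a b x s M (2 * j + 1)).symm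

/-- The Markov property on the scales beyond `s` under the limit law. -/
lemma map_stateHistory_prodMk_stateAt (hΨ : KernelContTendsto (halfTimeKernel f g μ) Ψ)
    (hP : Tendsto (fun N => solutionLaw f g μ N a b) atTop (𝓝 P)) (s J : ℕ) :
    (P : Measure (Lattice → X)).map
        (fun u => (stateHistory a b s J u, stateAt a b (s + 1) (2 * (J + 1)) u)) =
      (P : Measure (Lattice → X)).map (stateHistory a b s J) ⊗ₘ
        historyKernel f g a b Ψ s J := by
  have hst := continuous_stateAt a b (s + 1) (2 * (J + 1))
  have hhist := continuous_stateHistory a b s J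
  let trHist : ℕ → (ℕ → ℕ → X) → ℕ → ℕ → X := fun M h j => truncate M (h j)
  have htrHist : ∀ M, Continuous (trHist M) := fun M =>
    continuous_pi fun j => (continuous_truncate M).comp (continuous_apply j)
  have htrLim : ContTendsto (fun M u => trHist M (stateHistory a b s J u))
      (stateHistory a b s J) := by
    intro us u hu
    rw [tendsto_pi_nhds]
    exact fun j => contTendsto_truncate _ _ (((continuous_apply j).comp hhist).tendsto u |>.comp hu)
  have htrSol : ∀ M x, trHist M (stateHistory a b s J (regSolution f g (s + M) a b x)) =
      regHistory f g a b s M J x := by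
    intro M x
    funext j
    simp only [trHist, stateHistory, regHistory]
    split_ifs
    · exact truncate_stateAt_two_mul_regSolution f g a b x s M j
    · funext k
      simp [truncate]
  have hm1 : ∀ M, Measurable fun u => trHist M (stateHistory a b s J u) := fun M =>
    ((htrHist M).comp hhist).measurable
  have hm2 : ∀ M, Measurable fun u => (trHist M (stateHistory a b s J u),
      truncate M (stateAt a b (s + 1) (2 * (J + 1)) u)) := fun M =>
    (hm1 M).prodMk ((measurable_truncate M).comp hst.measurable)
  have hprob : ∀ M, IsProbabilityMeasure
      ((Measure.infinitePi fun _ : ℕ => μ).map (regHistory f g a b s M J)) := fun M =>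
    Measure.isProbabilityMeasure_map (measurable_regHistory f g a b s M J).aemeasurable
  have hprob1 : IsProbabilityMeasure ((P : Measure (Lattice → X)).map (stateHistory a b s J)) :=
    Measure.isProbabilityMeasure_map hhist.measurable.aemeasurable
  have hprob2 : IsProbabilityMeasure ((P : Measure (Lattice → X)).map
      (fun u => (stateHistory a b s J u, stateAt a b (s + 1) (2 * (J + 1)) u))) :=
    Measure.isProbabilityMeasure_map (hhist.prodMk hst).measurable.aemeasurable
  have hlim := weakTendsto_solutionLaw_add hP s
  have h1 := hlim.map (htrLim.prodMk (contTendsto_truncate_comp hst)) hm2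
    (hhist.prodMk hst).measurable
  have h2 : WeakTendsto (fun M => (Measure.infinitePi fun _ : ℕ => μ).map
      (regHistory f g a b s M J)) ((P : Measure (Lattice → X)).map (stateHistory a b s J)) := by
    refine (hlim.map htrLim hm1 hhist.measurable).congr' (Eventually.of_forall fun M => ?_)
    rw [solutionLaw_coe, Measure.map_map (hm1 M) (measurable_regSolution f g _ a b)]
    exact congrArg (fun F => Measure.map F _) (funext (htrSol M))
  have hm3 : ∀ M, Measurable fun p : (ℕ → ℕ → X) × (ℕ → X) => (p.1, truncate M p.2) := fun M =>
    measurable_fst.prodMk ((measurable_truncate M).comp measurable_snd)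
  -- The prelimit joint laws converge in two ways: as images of the solution laws, and through the
  -- convergence of the history kernels.
  have h3 := (h2.compProd (hΨ.historyKernel f g a b s J)).map
    ((ContTendsto.of_continuous continuous_fst).prodMk (contTendsto_truncate_comp continuous_snd))
    hm3 measurable_id
  rw [Measure.map_id'] at h3
  refine h1.unique (h3.congr' ?_)
  filter_upwards [eventually_ge_atTop 1] with M hM
  rw [← map_regHistory_prodMk_regState μ f g a b s M J hM, Measure.map_map (hm3 M)
    ((measurable_regHistory f g a b s M J).prodMk (measurable_regState f g _ a b s (J + 1))),
    solutionLaw_coe, Measure.map_map (hm2 M) (measurable_regSolution f g _ a b)]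
  congr 1
  funext x
  simp only [Function.comp, htrSol, truncate_stateAt_two_mul_regSolution]

/-- This is the Markov property beyond scale `s = 0`. Scale 0 is the prescribed boundary, so the
history kernel depends on the history only through its last state. -/
lemma hasCondDistrib_stateAtInt (hΨ : KernelContTendsto (halfTimeKernel f g μ) Ψ)
    (hP : Tendsto (fun N => solutionLaw f g μ N a b) atTop (𝓝 P)) (t : ℕ) :
    HasCondDistrib (stateAtInt a b (t + 1)) (fun u (i : Fin (t + 1)) => stateAtInt a b i u)
      ((unitTimeKernel g Ψ (b t)).comap (fun h : Fin (t + 1) → ℕ → X => h (Fin.last t))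
        (measurable_pi_apply _)) (P : Measure (Lattice → X)) := by
  let r : (ℕ → ℕ → X) → Fin (t + 1) → ℕ → X := fun h i => h i
  have hr : Measurable r := measurable_pi_lambda _ fun i => measurable_pi_apply _
  have hker : historyKernel f g a b Ψ 0 t = ((unitTimeKernel g Ψ (b t)).comap
      (fun h : Fin (t + 1) → ℕ → X => h (Fin.last t)) (measurable_pi_apply _)).comap r hr := by
    ext1 h
    rw [historyKernel, Kernel.comap_apply, Kernel.comap_apply, Kernel.comap_apply,
      stepKernel_eq_unitTimeKernel, fieldOfHistory, regField_zero]
    rfl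
  have hmain : HasCondDistrib (stateAtInt a b (t + 1)) (stateHistory a b 0 t)
      (((unitTimeKernel g Ψ (b t)).comap
      (fun h : Fin (t + 1) → ℕ → X => h (Fin.last t)) (measurable_pi_apply _)).comap r hr)
      (P : Measure (Lattice → X)) := by
    rw [← hker]
    exact ⟨((continuous_stateHistory a b 0 t).prodMk
      (continuous_stateAt a b 1 (2 * (t + 1)))).measurable.aemeasurable,
      map_stateHistory_prodMk_stateAt hΨ hP 0 t⟩
  -- The kernel factors through `r`, so conditioning on the first `t + 1` states replaces
  -- conditioning on the padded history.
  convert! hmain.comp_right using 1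
  funext u i
  have hi : (i : ℕ) ≤ t := by omega
  simp only [r, Function.comp, stateHistory, if_pos hi]
  rfl

lemma map_stateAtInt (hΨ : KernelContTendsto (halfTimeKernel f g μ) Ψ)
    (hP : Tendsto (fun N => solutionLaw f g μ N a b) atTop (𝓝 P)) (t : ℕ) :
    (P : Measure (Lattice → X)).map (stateAtInt a b t) = integerTimeKernel g Ψ b t a := by
  induction t with
  | zero =>
    have h0 : stateAtInt a b 0 = fun _ => a := funext fun u =>
      (stateAt_zero a b 0 u).trans (by simp)
    rw [h0, Measure.map_const, measure_univ, one_smul, integerTimeKernel, Kernel.id_apply]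
  | succ t ih =>
    have h := (hasCondDistrib_stateAtInt hΨ hP t).comp_right.map_eq
    have h2 := congrArg Measure.snd h
    have hm : Measurable (stateAtInt a b t) := (continuous_stateAt a b 1 (2 * t)).measurable
    rw [Measure.snd_compProd] at h2
    erw [Measure.snd_map_prodMk hm] at h2
    rw [h2, integerTimeKernel, Kernel.comp_apply, ← ih]
    rfl

end LimitLaw

end SpontStoch

end

/-! ### Assembly: integer and dyadic times -/

theorem theorem3 {X : Type*} [MetricSpace X] [CompleteSpace X] [SecondCountableTopology X]
    [MeasurableSpace X] [BorelSpace X] [AddGroup X] [ContinuousAdd X]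
    (f g : C(X × X, X)) (μ : Measure X) [IsProbabilityMeasure μ]
    (Ψ : Kernel (ℕ → X) (ℕ → X)) [IsMarkovKernel Ψ]
    (hfix : SpontStoch.stochasticRG f g Ψ = Ψ)
    (hlim : SpontStoch.KernelTendsto (SpontStoch.halfTimeKernel f g μ) Ψ)
    (a b : ℕ → X) :
    ∃ P : ProbabilityMeasure (SpontStoch.Lattice → X),
      -- weak convergence of the laws of the regularized solutions
      Tendsto (fun N => SpontStoch.solutionLaw f g μ N a b) atTop (𝓝 P) ∧
      -- the limit is supported on weak solutions of the ideal system
      (∀ᵐ u ∂(P : Measure (SpontStoch.Lattice → X)), SpontStoch.IsWeakSolution f g a b u) ∧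
      -- Markov property at integer times, with the kernels `Φ_{b_t}`
      SpontStoch.IsMarkovChain (P : Measure (SpontStoch.Lattice → X))
        (SpontStoch.stateAtInt a b) a (fun t => SpontStoch.unitTimeKernel g Ψ (b t)) ∧
      -- distributions at integer times
      (∀ t : ℕ, (P : Measure (SpontStoch.Lattice → X)).map (SpontStoch.stateAtInt a b t) =
        SpontStoch.integerTimeKernel g Ψ b t a) ∧
      -- distributions at the times `i + τ_n`
      (∀ i n : ℕ, 1 ≤ n →
        (P : Measure (SpontStoch.Lattice → X)).map (SpontStoch.stateAt a b n (i * 2 ^ n + 1)) =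
          (Ψ ∘ₖ SpontStoch.shiftUpKernel X (n - 1) ∘ₖ
            SpontStoch.integerTimeKernel g Ψ b i) a) ∧
      -- distributions at the times `t + τ_n`, where `t = m τ_s` and `n > s`
      (∀ s m n : ℕ, 1 ≤ s → s < n →
        (P : Measure (SpontStoch.Lattice → X)).map
            (SpontStoch.stateAt a b n (m * 2 ^ (n - s) + 1)) =
          (Ψ ∘ₖ SpontStoch.shiftUpKernel X (n - s)) ∘ₘ
            (P : Measure (SpontStoch.Lattice → X)).map (SpontStoch.stateAt a b s m)) := by
  have hΨ := hlim.kernelContTendsto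
  obtain ⟨P, hP⟩ := SpontStoch.exists_tendsto_solutionLaw hΨ a b
  have hshift : ∀ s d m : ℕ, (P : Measure (SpontStoch.Lattice → X)).map
      (SpontStoch.stateAt a b (s + d) (m * 2 ^ d)) = SpontStoch.shiftUpKernel X d ∘ₘ
        (P : Measure (SpontStoch.Lattice → X)).map (SpontStoch.stateAt a b s m) := by
    intro s d m
    rw [SpontStoch.shiftUpKernel, Measure.deterministic_comp_eq_map, Measure.map_map
      (SpontStoch.measurable_shiftUp_iterate d) (SpontStoch.continuous_stateAt a b s m).measurable]
    exact congrArg (fun F => Measure.map F _) (funext (SpontStoch.stateAt_add a b s d m))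
  have hint := SpontStoch.map_stateAtInt hΨ hP
  refine ⟨P, hP, SpontStoch.ae_isWeakSolution hP,
    ⟨hint 0, SpontStoch.hasCondDistrib_stateAtInt hΨ hP⟩, hint, fun i n hn => ?_,
    fun s m n _ hsn => ?_⟩
  · obtain ⟨d, rfl⟩ : ∃ d, n = d + 1 := ⟨n - 1, by omega⟩
    -- The time `i` equals `(i * 2 ^ d) τ_d`, so `i + τ_n` is a half-time step beyond scale `d = n -
    -- 1`, started from the `d`-fold shift of the integer-time state.
    have h := SpontStoch.map_stateAt_halfTime hΨ hP d (i * 2 ^ d)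
    have h2 := hshift 1 d (2 * i)
    rw [show 2 * (i * 2 ^ d) = i * 2 ^ (d + 1) by ring] at h
    rw [show 2 * i * 2 ^ d = i * 2 ^ (d + 1) by ring, Nat.add_comm 1 d] at h2
    rw [h, h2, Nat.add_sub_cancel, Kernel.comp_apply, ← hint i, Measure.comp_assoc]
    rfl
  · obtain ⟨d, rfl⟩ : ∃ d, n = s + (d + 1) := ⟨n - s - 1, by omega⟩
    -- The same half-time step beyond scale `s + d = n - 1`, started at `m τ_s = (m * 2 ^ d) τ_{s +
    -- d}`.
    have h := SpontStoch.map_stateAt_halfTime hΨ hP (s + d) (m * 2 ^ d)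
    have h2 := hshift s (d + 1) m
    rw [show 2 * (m * 2 ^ d) = m * 2 ^ (d + 1) by ring, add_assoc] at h
    rw [Nat.add_sub_cancel_left, h, h2, Measure.comp_assoc]
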